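/- Let $\nu>0$, $0<f<1$, and $\overline\Lambda=\frac{2-f}{2}$. On the complex Hilbert space $[L^2(\mathbb R^3)]^3$, with points of $\mathbb R^3$ written $(x,y,z)$ and $\mathbf u=(u_1,u_2,u_3)$, consider the operator $$ \mathscr L=(\nu\Delta-y\,\partial_x)I_3+\begin{pmatrix} f\Delta^{-1}\partial_{xy} & f-1+(2-f)\Delta^{-1}\partial_x^2 & 0\\ -f+f\Delta^{-1}\partial_y^2 & (2-f)\Delta^{-1}\partial_{xy} & 0\\ f\Delta^{-1}\partial_{yz} & (2-f)\Delta^{-1}\partial_{xz} & 0 \end{pmatrix} $$ with domain $$ \mathcal D(\mathscr L)=\{\mathbf u\in[L^2(\mathbb R^3)]^3 : \Delta\mathbf u\in[L^2(\mathbb R^3)]^3,\ y\,\partial_x\mathbf u\in[L^2(\mathbb R^3)]^3\}. $$ Here the derivatives are taken in the sense of distributions, and $\Delta^{-1}\partial_i\partial_j$ is the bounded Fourier multiplier on $L^2(\mathbb R^3)$ with symbol $\xi_i\xi_j/|\xi|^2$. Let $\lambda\in\mathbb C$ with $\Re\lambda>\overline\Lambda$. Then $\lambda$ belongs to the resolvent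 set of $\mathscr L$, that is, $\lambda-\mathscr L:\mathcal D(\mathscr L)\to[L^2(\mathbb R^3)]^3$ is bijective with a bounded inverse, and $$ \|(\lambda-\mathscr L)^{-1}\|_{L^2\to L^2}\le\frac{1}{\Re\lambda-\overline\Lambda}. $$ -/

import Mathlib

open MeasureTheory SchwartzMap FourierTransform
open scoped ENNReal

noncomputable section

/-! ### Resolvents of unbounded operators -/

/-- The bounded operator `R` is the inverse of `z - T : D(T) → E`. -/
def LinearPMap.IsResolventAt {E : Type*} [NormedAddCommGroup E] [NormedSpace ℂ E]
    (T : E →ₗ.[ℂ] E) (z : ℂ) (R : E →L[ℂ] E) : Prop :=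
  (∀ w : E, ∃ h : R w ∈ T.domain, z • R w - T ⟨R w, h⟩ = w) ∧
    ∀ u : T.domain, R (z • (u : E) - T u) = u

/-- The resolvent set of an unbounded operator `T`: the set of all `z` such that
`z - T : D(T) → E` is a bijection with a bounded inverse. -/
def LinearPMap.resolventSet {E : Type*} [NormedAddCommGroup E] [NormedSpace ℂ E]
    (T : E →ₗ.[ℂ] E) : Set ℂ :=
  {z | ∃ R : E →L[ℂ] E, T.IsResolventAt z R}

namespace Couette

/-- Physical space `ℝ³`; the coordinates `x`, `y`, `z` are `p 0`, `p 1`, `p 2`. -/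
abbrev R3 : Type := EuclideanSpace ℝ (Fin 3)

/-- The space `L²(ℝ³)` of complex-valued functions. -/
abbrev L2 : Type := Lp (α := R3) ℂ 2 volume

/-- The Hilbert space `[L²(ℝ³)]³`. -/
abbrev L2Vec : Type := PiLp 2 (fun _ : Fin 3 => L2)

/-- The inclusion of `L²(ℝ³)` into the tempered distributions. -/
def toDist : L2 →ₗ[ℂ] 𝓢'(R3, ℂ) :=
  (Lp.toTemperedDistributionCLM (E := R3) ℂ volume 2).toLinearMap

theorem toDist_injective : Function.Injective toDist :=
  LinearMap.ker_eq_bot.mp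
    (Lp.ker_toTemperedDistributionCLM_eq_bot (E := R3) (F := ℂ) (μ := volume) (p := 2))

/-- The maximal realization in `L²(ℝ³)` of an operator `A` on distributions:
its domain consists of all `u ∈ L²` for which the distribution `A u` belongs to `L²`,
and there it maps `u` to `A u`. -/
def l2Realization (A : 𝓢'(R3, ℂ) →ₗ[ℂ] 𝓢'(R3, ℂ)) : L2 →ₗ.[ℂ] L2 where
  domain := (LinearMap.range toDist).comap (A ∘ₗ toDist)
  toFun := (LinearEquiv.ofInjective toDist toDist_injective).symm.toLinearMap ∘ₗ
    LinearMap.codRestrict (LinearMap.range toDist)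
      ((A ∘ₗ toDist).domRestrict ((LinearMap.range toDist).comap (A ∘ₗ toDist)))
      (fun u => u.2)

theorem mem_l2Realization_domain (A : 𝓢'(R3, ℂ) →ₗ[ℂ] 𝓢'(R3, ℂ)) (u : L2) :
    u ∈ (l2Realization A).domain ↔ ∃ g : L2, toDist g = A (toDist u) :=
  Iff.rfl

theorem toDist_l2Realization (A : 𝓢'(R3, ℂ) →ₗ[ℂ] 𝓢'(R3, ℂ)) (u : (l2Realization A).domain) :
    toDist (l2Realization A u) = A (toDist u) :=
  congrArg Subtype.val
    ((LinearEquiv.ofInjective toDist toDist_injective).apply_symm_apply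
      ⟨A (toDist u), u.2⟩)

/-- The distributional Laplacian in `L²(ℝ³)`, on `{u ∈ L² | Δ u ∈ L²}`. -/
def laplacianL2 : L2 →ₗ.[ℂ] L2 :=
  l2Realization (LineDeriv.laplacianCLM ℂ R3 𝓢'(R3, ℂ)).toLinearMap

/-- The distributional operator `y ∂ₓ` in `L²(ℝ³)`, on `{u ∈ L² | y ∂ₓ u ∈ L²}`. -/
def yDx : L2 →ₗ.[ℂ] L2 :=
  l2Realization
    (TemperedDistribution.smulLeftCLM ℂ (fun p : R3 => ((p 1 : ℝ) : ℂ)) ∘L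
      LineDeriv.lineDerivOpCLM ℂ 𝓢'(R3, ℂ) (EuclideanSpace.single (0 : Fin 3) (1 : ℝ))).toLinearMap

/-- The Fourier symbol `ξᵢ ξⱼ / |ξ|²` of `Δ⁻¹ ∂ᵢ ∂ⱼ`. -/
def rieszSymbol (i j : Fin 3) (ξ : R3) : ℂ :=
  ((ξ i * ξ j / ‖ξ‖ ^ 2 : ℝ) : ℂ)

theorem memLp_rieszSymbol (i j : Fin 3) : MemLp (rieszSymbol i j) ∞ (volume : Measure R3) := by
  refine memLp_top_of_bound (C := 1) ?_ (Filter.Eventually.of_forall fun ξ => ?_)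
  · refine Measurable.aestronglyMeasurable ?_
    unfold rieszSymbol
    fun_prop
  · have hi : |ξ i| ≤ ‖ξ‖ := PiLp.norm_apply_le ξ i
    have hj : |ξ j| ≤ ‖ξ‖ := PiLp.norm_apply_le ξ j
    rw [rieszSymbol, Complex.norm_real, Real.norm_eq_abs, abs_div, abs_mul,
      abs_of_nonneg (sq_nonneg ‖ξ‖), sq]
    exact div_le_one_of_le₀ (mul_le_mul hi hj (abs_nonneg _) (norm_nonneg _)) (by positivity)

/-- The bounded operator `Δ⁻¹ ∂ᵢ ∂ⱼ` on `L²(ℝ³)`: the Fourier multiplier with symbol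
`ξᵢ ξⱼ / |ξ|²`. -/
def invLaplacianD (i j : Fin 3) : L2 →L[ℂ] L2 :=
  (fourierInvCLM ℂ L2) ∘L
    ((ContinuousLinearMap.mul ℂ ℂ).holderL volume ∞ 2 2 ((memLp_rieszSymbol i j).toLp _)) ∘L
      (fourierCLM ℂ L2)

/-- The bounded operator on `[L²(ℝ³)]³` given by a matrix of bounded operators on `L²(ℝ³)`. -/
def matrixOp (B : Matrix (Fin 3) (Fin 3) (L2 →L[ℂ] L2)) : L2Vec →ₗ[ℂ] L2Vec where
  toFun u := WithLp.toLp 2 fun i => ∑ j, B i j (u j)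
  map_add' u v := by
    ext1 i
    simp [Finset.sum_add_distrib]
  map_smul' c u := by
    ext1 i
    simp [Finset.smul_sum]

/-- The unbounded operator `diag (T, T, T)` on `[L²(ℝ³)]³`, on `D(T)³`. -/
def diagOp (T : L2 →ₗ.[ℂ] L2) : L2Vec →ₗ.[ℂ] L2Vec where
  domain :=
    { carrier := {u | ∀ i, u i ∈ T.domain}
      add_mem' := fun hu hv i => T.domain.add_mem (hu i) (hv i)
      zero_mem' := fun _ => T.domain.zero_mem
      smul_mem' := fun c _ hu i => T.domain.smul_mem c (hu i) }
  toFun :=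
    { toFun := fun u => WithLp.toLp 2 fun i => T ⟨u.1 i, u.2 i⟩
      map_add' := fun u v => by
        ext1 i
        exact T.map_add ⟨u.1 i, u.2 i⟩ ⟨v.1 i, v.2 i⟩
      map_smul' := fun c u => by
        ext1 i
        exact T.map_smul c ⟨u.1 i, u.2 i⟩ }

/-- `𝓛₀`, the part of the linearized operator whose form does not change when the velocity is
independent of `x`. -/
def opL0 (ν f : ℝ) : L2Vec →ₗ.[ℂ] L2Vec :=
  matrixOp
    !![0, ((f - 1 : ℝ) : ℂ) • ContinuousLinearMap.id ℂ L2, 0;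
       -((f : ℂ) • ContinuousLinearMap.id ℂ L2) + (f : ℂ) • invLaplacianD 1 1, 0, 0;
       (f : ℂ) • invLaplacianD 1 2, 0, 0]
    +ᵥ ((ν : ℂ) • diagOp laplacianL2)

/-- `𝓛₁`, the bounded part of the linearized operator with derivatives in `x`. -/
def opL1 (f : ℝ) : L2Vec →ₗ[ℂ] L2Vec :=
  matrixOp
    !![(f : ℂ) • invLaplacianD 0 1, ((2 - f : ℝ) : ℂ) • invLaplacianD 0 0, 0;
       0, ((2 - f : ℝ) : ℂ) • invLaplacianD 0 1, 0;
       0, ((2 - f : ℝ) : ℂ) • invLaplacianD 0 2, 0]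

/-- `𝓛₂ = -diag (y ∂ₓ, y ∂ₓ, y ∂ₓ)`. -/
def opL2 : L2Vec →ₗ.[ℂ] L2Vec := -diagOp yDx

/-- The linearized operator `𝓛 = 𝓛₀ + 𝓛₁ + 𝓛₂` around the rotating Couette flow. -/
def linearizedOp (ν f : ℝ) : L2Vec →ₗ.[ℂ] L2Vec :=
  opL1 f +ᵥ (opL0 ν f + opL2)

/-- The domain of `𝓛` is `{u ∈ [L²]³ | Δ u, y ∂ₓ u ∈ [L²]³}`. -/
theorem mem_linearizedOp_domain (ν f : ℝ) (u : L2Vec) :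
    u ∈ (linearizedOp ν f).domain ↔
      (∀ i, u i ∈ laplacianL2.domain) ∧ ∀ i, u i ∈ yDx.domain :=
  Iff.rfl

/-- The growth bound `Λ̄ = (2 - f) / 2`. -/
def upperRate (f : ℝ) : ℝ := (2 - f) / 2

end Couette

end

/-!
Put `𝓛 = ν Δ - y ∂ₓ + B`, where `B` is the bounded part, a matrix of Fourier multipliers. Two facts
give the theorem.

*Dissipativity.* `Re ⟪u, 𝓛 u⟫ ≤ Λ̄ ‖u‖²` on the domain (`re_inner_linearizedOp_le`). The Laplacian
contributes a nonpositive term by Plancherel. The transport term contributes nothing: since `Δ u`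
is square-integrable, so is `∂ₓ u`, and after `y` is truncated to a bounded coefficient that still
does not depend on `x`, the statement is an integration by parts; the truncation is removed by
dominated convergence (`re_inner_yDx_eq_zero`). For `B` the bound is one on the Hermitian part of
its symbol. That quadratic form is affine in `f`, as is `Λ̄`, so it suffices to treat `f = 0` and
`f = 1`, where completing squares works (`quadForm_zero_le`, `quadForm_one_le`). Dissipativity gives
injectivity of `z - 𝓛` and the bound on the inverse.

*Surjectivity.* The equation `(z - 𝓛) u = g` is solved on the Fourier side, where `y ∂ₓ` becomes the
transport operator `-∂₁ ξ₀`, by Lions' projection method (`exists_inner_apply_eq`). The solution is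
sought in the form `û = m w` with the weight `m = 1 / (1 + κ|ξ|²)`, `κ = (2π)² ν`, and `w` in `L²`.
For this it is enough that the transposed operator, multiplied by `m`, is coercive in `L²` on
Schwartz functions (`coercive_testMap`). The symbol of `B` commutes with `m`, and the commutator of
the transport operator with `m` contributes `κ ξ₀ ξ₁ m²`, which the term `κ|ξ|² m` absorbs
(`weight_estimate`). The factor `m` makes `Δ u` square-integrable, and the equation then puts
`y ∂ₓ u` in `L²`, so that `u` lies in the domain and no separate regularity theory is needed
(`exists_sub_linearizedOp_eq`).
-/

noncomputable section

namespace Couette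

open LineDeriv Laplacian

/-! ### Square-integrable functions as tempered distributions -/

theorem toDist_apply (u : L2) (φ : 𝓢(R3, ℂ)) : toDist u φ = ∫ x, φ x * u x :=
  Lp.toTemperedDistribution_apply u φ

theorem fourier_toDist (u : L2) : 𝓕 (toDist u) = toDist (𝓕 u) :=
  Lp.fourier_toTemperedDistribution_eq u

theorem toDist_eq_smulLeftCLM_of_ae {a : R3 → ℂ} (ha : a.HasTemperateGrowth) {g h : L2}
    (hgh : g =ᵐ[volume] fun x => a x * h x) :
    toDist g = TemperedDistribution.smulLeftCLM ℂ a (toDist h) := by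
  ext φ
  rw [TemperedDistribution.smulLeftCLM_apply_apply, toDist_apply, toDist_apply]
  refine integral_congr_ae ?_
  filter_upwards [hgh] with x hx
  rw [hx, SchwartzMap.smulLeftCLM_apply_apply ha, smul_eq_mul]
  ring

/-- Distributions determine square-integrable functions, also up to a smooth factor: test with
compactly supported smooth functions. -/
theorem ae_eq_of_toDist_eq_smulLeftCLM {a : R3 → ℂ} (ha : a.HasTemperateGrowth) {g h : L2}
    (hgh : toDist g = TemperedDistribution.smulLeftCLM ℂ a (toDist h)) :
    g =ᵐ[volume] fun x => a x * h x := by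
  have hh : LocallyIntegrable (fun x => a x * h x) (volume : Measure R3) :=
    ((Lp.memLp h).locallyIntegrable (by norm_num)).continuous_mul ha.1.continuous
  refine ae_eq_of_integral_contDiff_smul_eq ((Lp.memLp g).locallyIntegrable (by norm_num)) hh
    fun φ hφ hφc => ?_
  have h1 : HasCompactSupport (Complex.ofRealCLM ∘ φ) := hφc.comp_left rfl
  have h2 : ContDiff ℝ (⊤ : ℕ∞) (Complex.ofRealCLM ∘ φ) :=
    Complex.ofRealCLM.contDiff.comp hφ
  have := congrArg (fun T : 𝓢'(R3, ℂ) => T (h1.toSchwartzMap h2)) hgh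
  simp only [TemperedDistribution.smulLeftCLM_apply_apply, toDist_apply,
    SchwartzMap.smulLeftCLM_apply_apply ha] at this
  refine Eq.trans ?_ (this.trans ?_)
  · exact integral_congr_ae (Filter.Eventually.of_forall fun x => by simp)
  · refine integral_congr_ae (Filter.Eventually.of_forall fun x => ?_)
    simp only [HasCompactSupport.toSchwartzMap_toFun, Function.comp_apply,
      Complex.ofRealCLM_apply, smul_eq_mul, Complex.real_smul]
    ring

theorem toDist_eq_smulLeftCLM_iff {a : R3 → ℂ} (ha : a.HasTemperateGrowth) {g h : L2} :
    toDist g = TemperedDistribution.smulLeftCLM ℂ a (toDist h) ↔ g =ᵐ[volume] fun x => a x * h x :=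
  ⟨ae_eq_of_toDist_eq_smulLeftCLM ha, toDist_eq_smulLeftCLM_of_ae ha⟩

/-- Multiplication by a bounded function, as a bounded operator on `L²(ℝ³)`. -/
def mulL2 (a : R3 → ℂ) (ha : MemLp a ∞ (volume : Measure R3)) : L2 →L[ℂ] L2 :=
  (ContinuousLinearMap.mul ℂ ℂ).holderL volume ∞ 2 2 (ha.toLp a)

theorem coeFn_mulL2 (a : R3 → ℂ) (ha : MemLp a ∞ (volume : Measure R3)) (u : L2) :
    mulL2 a ha u =ᵐ[volume] fun x => a x * u x := by
  have h := (ContinuousLinearMap.mul ℂ ℂ).coeFn_holder (r := 2) (ha.toLp a) u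
  filter_upwards [h, ha.coeFn_toLp] with x hx hx'
  rw [← hx']
  exact hx

theorem fourier_invLaplacianD (i j : Fin 3) (u : L2) :
    𝓕 (invLaplacianD i j u) = mulL2 (rieszSymbol i j) (memLp_rieszSymbol i j) (𝓕 u) :=
  fourier_fourierInv_eq (_ : L2)

theorem hasTemperateGrowth_coord (i : Fin 3) :
    (fun x : R3 => ((x i : ℝ) : ℂ)).HasTemperateGrowth := by
  have : (fun x : R3 => ((x i : ℝ) : ℂ)) =
      (Complex.ofRealCLM ∘L (EuclideanSpace.proj i : R3 →L[ℝ] ℝ)) := by ext; rfl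
  rw [this]
  exact ContinuousLinearMap.hasTemperateGrowth _

theorem inner_single_one (x : R3) (i : Fin 3) :
    inner ℝ x (EuclideanSpace.single i (1 : ℝ)) = x i := by
  simp [EuclideanSpace.inner_single_right]

/-- On the Fourier side the Laplacian is multiplication by `-(2π)²|ξ|²`. -/
theorem toDist_eq_laplacian_iff {g u : L2} :
    toDist g = Δ (toDist u) ↔
      (𝓕 g : L2) =ᵐ[volume] fun ξ => ((-(2 * Real.pi) ^ 2 * ‖ξ‖ ^ 2 : ℝ) : ℂ) * (𝓕 u : L2) ξ := by
  have ht : (fun ξ : R3 => ((-(2 * Real.pi) ^ 2 * ‖ξ‖ ^ 2 : ℝ) : ℂ)).HasTemperateGrowth := by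
    fun_prop
  rw [← toDist_eq_smulLeftCLM_iff ht, ← fourier_toDist, ← fourier_toDist]
  have : 𝓕 (Δ (toDist u)) =
      TemperedDistribution.smulLeftCLM ℂ (fun ξ : R3 => ((-(2 * Real.pi) ^ 2 * ‖ξ‖ ^ 2 : ℝ) : ℂ))
        (𝓕 (toDist u)) := by
    rw [TemperedDistribution.laplacian_eq_fourierMultiplierCLM,
      TemperedDistribution.fourierMultiplierCLM_apply]
    have h2 : (fun ξ : R3 => ((-(2 * Real.pi) ^ 2 * ‖ξ‖ ^ 2 : ℝ) : ℂ)) =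
        ((-(2 * Real.pi) ^ 2 : ℝ) : ℂ) • fun ξ : R3 => ((‖ξ‖ ^ 2 : ℝ) : ℂ) := by
      ext ξ; simp
    rw [h2, TemperedDistribution.smulLeftCLM_smul (by fun_prop), ← Complex.coe_smul,
      FourierTransform.fourier_smul,
      fourier_fourierInv_eq]
    rfl
  rw [← this]
  exact ⟨fun h => by rw [h], fun h => by simpa using congrArg (𝓕⁻ ·) h⟩

/-- On the Fourier side `∂ᵢ` is multiplication by `2πi ξᵢ`. -/
theorem toDist_eq_lineDeriv_iff {g u : L2} (i : Fin 3) :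
    toDist g = ∂_{(EuclideanSpace.single i (1 : ℝ) : R3)} (toDist u) ↔
      (𝓕 g : L2) =ᵐ[volume] fun ξ => (2 * Real.pi * Complex.I * ξ i) * (𝓕 u : L2) ξ := by
  have ht : (fun ξ : R3 => (2 * Real.pi * Complex.I * ((ξ i : ℝ) : ℂ))).HasTemperateGrowth :=
    (Function.HasTemperateGrowth.const _).mul (hasTemperateGrowth_coord i)
  rw [← toDist_eq_smulLeftCLM_iff ht, ← fourier_toDist, ← fourier_toDist]
  have : 𝓕 (∂_{(EuclideanSpace.single i (1 : ℝ) : R3)} (toDist u)) =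
      TemperedDistribution.smulLeftCLM ℂ (fun ξ : R3 => (2 * Real.pi * Complex.I * ((ξ i : ℝ) : ℂ)))
        (𝓕 (toDist u)) := by
    rw [TemperedDistribution.fourier_lineDerivOp_eq]
    have h2 : (fun ξ : R3 => (2 * Real.pi * Complex.I * ((ξ i : ℝ) : ℂ))) =
        (2 * Real.pi * Complex.I) • fun ξ : R3 => ((ξ i : ℝ) : ℂ) := by
      ext ξ; simp
    rw [h2, TemperedDistribution.smulLeftCLM_smul (hasTemperateGrowth_coord i)]
    simp only [inner_single_one]
    rfl
  rw [← this]
  exact ⟨fun h => by rw [h], fun h => by simpa using congrArg (𝓕⁻ ·) h⟩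

/-! ### The symbol of the bounded part -/

/-- The case `f = 0` of `quadForm_le`. -/
theorem quadForm_zero_le {a b c : ℝ} (h : a ^ 2 + b ^ 2 + c ^ 2 = 1) (x y w : ℝ) :
    2 * (a * x + b * y + c * w) * (a * y) - x * y ≤ x ^ 2 + y ^ 2 + w ^ 2 := by
  have hab : a * b ≤ 1 / 2 := by nlinarith [sq_nonneg (a - b), sq_nonneg c]
  have hc : c ^ 2 = 1 - a ^ 2 - b ^ 2 := by linarith
  have key : x ^ 2 + y ^ 2 + w ^ 2 - (2 * (a * x + b * y + c * w) * (a * y) - x * y) =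
      (x - (2 * a ^ 2 - 1) / 2 * y) ^ 2 + (w - a * c * y) ^ 2
        + (3 / 2 - a * b) * (1 / 2 - a * b) * y ^ 2 := by
    linear_combination (-a ^ 2 * y ^ 2) * h
  -- the last coefficient is nonnegative because `2ab ≤ a² + b² ≤ 1`
  have h3 : 0 ≤ (3 / 2 - a * b) * (1 / 2 - a * b) * y ^ 2 :=
    mul_nonneg (mul_nonneg (by linarith) (by linarith)) (sq_nonneg y)
  nlinarith [sq_nonneg (x - (2 * a ^ 2 - 1) / 2 * y), sq_nonneg (w - a * c * y)]

/-- The case `f = 1` of `quadForm_le`. -/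
theorem quadForm_one_le {a b c : ℝ} (h : a ^ 2 + b ^ 2 + c ^ 2 = 1) (x y w : ℝ) :
    (a * x + b * y + c * w) * (b * x + a * y) - x * y ≤ 1 / 2 * (x ^ 2 + y ^ 2 + w ^ 2) := by
  have key : x ^ 2 + y ^ 2 + w ^ 2 - 2 * ((a * x + b * y + c * w) * (b * x + a * y) - x * y) =
      (w - c * (b * x + a * y)) ^ 2 + (a - b) ^ 2 * (x ^ 2 + y ^ 2)
        + c ^ 2 * ((x + y) ^ 2 - (b * x + a * y) ^ 2) := by
    linear_combination (-(x + y) ^ 2) * h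
  have hs : (a + b) ^ 2 ≤ 2 := by nlinarith [sq_nonneg (a - b), sq_nonneg c]
  have hc : c ^ 2 ≤ 1 := by nlinarith [sq_nonneg a, sq_nonneg b]
  -- the last two terms, in the variables `x + y` and `x - y`
  have key2 : (a - b) ^ 2 * (x ^ 2 + y ^ 2) + c ^ 2 * ((x + y) ^ 2 - (b * x + a * y) ^ 2) =
      c ^ 2 * ((a + b) * (x + y) + (a - b) * (x - y)) ^ 2 / 4
        + (a - b) ^ 2 * (x + y) ^ 2 / 2 + (a - b) ^ 2 * (x - y) ^ 2 * (1 - c ^ 2) / 2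
        + c ^ 2 * (x + y) ^ 2 * (1 - (a + b) ^ 2 / 2) := by
    ring
  have p1 : 0 ≤ (a - b) ^ 2 * (x - y) ^ 2 * (1 - c ^ 2) :=
    mul_nonneg (by positivity) (by linarith)
  have p2 : 0 ≤ c ^ 2 * (x + y) ^ 2 * (1 - (a + b) ^ 2 / 2) :=
    mul_nonneg (by positivity) (by linarith)
  have p3 : 0 ≤ c ^ 2 * ((a + b) * (x + y) + (a - b) * (x - y)) ^ 2 / 4 := by positivity
  have p4 : 0 ≤ (a - b) ^ 2 * (x + y) ^ 2 / 2 := by positivity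
  have p5 : 0 ≤ (w - c * (b * x + a * y)) ^ 2 := sq_nonneg _
  linarith

/-- The bound on the quadratic form of the symbol at a unit frequency `(a, b, c)`. Both sides are
affine in `f`, which reduces it to `f = 0` and `f = 1`. -/
theorem quadForm_le {f : ℝ} (hf0 : 0 < f) (hf1 : f < 1) {a b c : ℝ}
    (h : a ^ 2 + b ^ 2 + c ^ 2 = 1) (x y w : ℝ) :
    (a * x + b * y + c * w) * (f * b * x + (2 - f) * a * y) - x * y ≤
      upperRate f * (x ^ 2 + y ^ 2 + w ^ 2) := by
  have h0 := mul_le_mul_of_nonneg_left (quadForm_zero_le h x y w) (sub_nonneg.2 hf1.le)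
  have h1 := mul_le_mul_of_nonneg_left (quadForm_one_le h x y w) hf0.le
  unfold upperRate
  linarith

/-- The entry `(i, j)` of the symbol of the bounded part of the linearized operator. -/
def symbol (f : ℝ) (i j : Fin 3) (ξ : R3) : ℂ :=
  !![f * rieszSymbol 0 1 ξ, ((f - 1 : ℝ) : ℂ) + ((2 - f : ℝ) : ℂ) * rieszSymbol 0 0 ξ, 0;
     -(f : ℂ) + f * rieszSymbol 1 1 ξ, ((2 - f : ℝ) : ℂ) * rieszSymbol 0 1 ξ, 0;
     f * rieszSymbol 1 2 ξ, ((2 - f : ℝ) : ℂ) * rieszSymbol 0 2 ξ, 0] i j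

theorem memLp_symbol (f : ℝ) (i j : Fin 3) : MemLp (symbol f i j) ∞ (volume : Measure R3) := by
  have h := memLp_rieszSymbol
  have hc : ∀ c : ℂ, MemLp (fun _ : R3 => c) ∞ (volume : Measure R3) := memLp_top_const
  unfold symbol
  fin_cases i <;> fin_cases j
  · exact (h 0 1).const_mul _
  · exact (hc _).add ((h 0 0).const_mul _)
  · exact hc 0
  · exact (hc _).add ((h 1 1).const_mul _)
  · exact (h 0 1).const_mul _
  · exact hc 0
  · exact (h 1 2).const_mul _
  · exact (h 0 2).const_mul _
  · exact hc 0

/-- The Hermitian part of the symbol is at most `(2 - f) / 2`. -/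
theorem re_symbol_le {f : ℝ} (hf0 : 0 < f) (hf1 : f < 1) (ξ : R3) (v : Fin 3 → ℂ) :
    (∑ i, inner ℂ (v i) (∑ j, symbol f i j ξ * v j)).re ≤ upperRate f * ∑ i, ‖v i‖ ^ 2 := by
  -- at `ξ = 0` the Riesz symbols take the value `0`, and only the constant part is left
  obtain rfl | hξ := eq_or_ne ξ 0
  · have hr : ∀ i j, rieszSymbol i j 0 = 0 := fun i j => by simp [rieszSymbol]
    simp only [symbol, hr, Fin.sum_univ_three, RCLike.inner_apply, Complex.sq_norm,
      Complex.normSq_apply, upperRate]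
    simp
    nlinarith [sq_nonneg ((v 0).re + (v 1).re), sq_nonneg ((v 0).im + (v 1).im),
      sq_nonneg (v 2).re, sq_nonneg (v 2).im, sq_nonneg (v 0).re, sq_nonneg (v 0).im,
      sq_nonneg (v 1).re, sq_nonneg (v 1).im]
  · have hn : ‖ξ‖ ≠ 0 := norm_ne_zero_iff.2 hξ
    have h1 : (ξ 0 / ‖ξ‖) ^ 2 + (ξ 1 / ‖ξ‖) ^ 2 + (ξ 2 / ‖ξ‖) ^ 2 = 1 := by
      have := EuclideanSpace.real_norm_sq_eq ξ
      rw [Fin.sum_univ_three] at this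
      field_simp
      linarith
    have hr : ∀ i j, rieszSymbol i j ξ = ((ξ i / ‖ξ‖ * (ξ j / ‖ξ‖) : ℝ) : ℂ) := fun i j => by
      rw [rieszSymbol]; congr 1; field_simp
    have hre := quadForm_le hf0 hf1 h1 (v 0).re (v 1).re (v 2).re
    have him := quadForm_le hf0 hf1 h1 (v 0).im (v 1).im (v 2).im
    simp only [symbol, hr, Fin.sum_univ_three, RCLike.inner_apply, Complex.sq_norm,
      Complex.normSq_apply]
    generalize ξ 0 / ‖ξ‖ = a at *
    generalize ξ 1 / ‖ξ‖ = b at *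
    generalize ξ 2 / ‖ξ‖ = c at *
    simp
    linarith

/-- The real symbol has the same Hermitian part as its transpose. -/
theorem re_symbol_transpose_eq (f : ℝ) (ξ : R3) (v : Fin 3 → ℂ) :
    (∑ j, inner ℂ (v j) (∑ i, symbol f i j ξ * v i)).re =
      (∑ i, inner ℂ (v i) (∑ j, symbol f i j ξ * v j)).re := by
  simp only [symbol, rieszSymbol, Fin.sum_univ_three, RCLike.inner_apply]
  generalize ξ 0 * ξ 0 / ‖ξ‖ ^ 2 = r00
  generalize ξ 0 * ξ 1 / ‖ξ‖ ^ 2 = r01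
  generalize ξ 0 * ξ 2 / ‖ξ‖ ^ 2 = r02
  generalize ξ 1 * ξ 1 / ‖ξ‖ ^ 2 = r11
  generalize ξ 1 * ξ 2 / ‖ξ‖ ^ 2 = r12
  simp
  ring

/-- The bounded part of the linearized operator: everything except `ν Δ - y ∂ₓ`. -/
def boundedPart (f : ℝ) : L2Vec →ₗ[ℂ] L2Vec :=
  opL1 f + matrixOp
    !![0, ((f - 1 : ℝ) : ℂ) • ContinuousLinearMap.id ℂ L2, 0;
       -((f : ℂ) • ContinuousLinearMap.id ℂ L2) + (f : ℂ) • invLaplacianD 1 1, 0, 0;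
       (f : ℂ) • invLaplacianD 1 2, 0, 0]

theorem linearizedOp_apply (ν f : ℝ) (u : (linearizedOp ν f).domain) (i : Fin 3) :
    linearizedOp ν f u i = boundedPart f u i + (ν : ℂ) • laplacianL2 ⟨(u : L2Vec) i, u.2.1 i⟩
      - yDx ⟨(u : L2Vec) i, u.2.2 i⟩ := by
  have h : linearizedOp ν f u i = opL1 f u i + ((matrixOp
    !![0, ((f - 1 : ℝ) : ℂ) • ContinuousLinearMap.id ℂ L2, 0;
       -((f : ℂ) • ContinuousLinearMap.id ℂ L2) + (f : ℂ) • invLaplacianD 1 1, 0, 0;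
       (f : ℂ) • invLaplacianD 1 2, 0, 0] u i + (ν : ℂ) • laplacianL2 ⟨(u : L2Vec) i, u.2.1 i⟩)
      + -yDx ⟨(u : L2Vec) i, u.2.2 i⟩) := rfl
  rw [h, boundedPart, LinearMap.add_apply, PiLp.add_apply]
  abel

theorem mulL2_eq_of_affine {a : R3 → ℂ} (ha : MemLp a ∞ (volume : Measure R3)) {α β : ℂ}
    {i j : Fin 3} (h : ∀ ξ, a ξ = α + β * rieszSymbol i j ξ) (u : L2) :
    mulL2 a ha (𝓕 u) = 𝓕 (α • u + β • invLaplacianD i j u) := by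
  rw [FourierTransform.fourier_add, FourierTransform.fourier_smul, FourierTransform.fourier_smul,
    fourier_invLaplacianD]
  refine Lp.ext ?_
  filter_upwards [coeFn_mulL2 a ha (𝓕 u), coeFn_mulL2 _ (memLp_rieszSymbol i j) (𝓕 u),
    Lp.coeFn_add (α • 𝓕 u : L2) (β • mulL2 _ (memLp_rieszSymbol i j) (𝓕 u)),
    Lp.coeFn_smul α (𝓕 u : L2), Lp.coeFn_smul β (mulL2 _ (memLp_rieszSymbol i j) (𝓕 u))]
    with ξ h1 h2 h3 h4 h5
  rw [h1, h3, Pi.add_apply, h4, h5, Pi.smul_apply, Pi.smul_apply, h2, h]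
  simp only [smul_eq_mul]
  ring

/-- On the Fourier side the bounded part is multiplication by the symbol. -/
theorem fourier_boundedPart (f : ℝ) (u : L2Vec) (i : Fin 3) :
    𝓕 (boundedPart f u i : L2)
      = ∑ j, mulL2 (symbol f i j) (memLp_symbol f i j) (𝓕 (u j)) := by
  rw [Fin.sum_univ_three]
  fin_cases i
  · rw [mulL2_eq_of_affine (α := 0) (β := f) (i := 0) (j := 1) _ (fun ξ => by simp [symbol]),
      mulL2_eq_of_affine (α := ((f - 1 : ℝ) : ℂ)) (β := ((2 - f : ℝ) : ℂ)) (i := 0) (j := 0) _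
        (fun ξ => by simp [symbol]),
      mulL2_eq_of_affine (α := 0) (β := 0) (i := 0) (j := 0) _ (fun ξ => by simp [symbol]),
      ← FourierTransform.fourier_add, ← FourierTransform.fourier_add]
    congr 1
    simp [boundedPart, opL1, matrixOp, Fin.sum_univ_three, -Complex.coe_smul]
    abel
  · rw [mulL2_eq_of_affine (α := -(f : ℂ)) (β := f) (i := 1) (j := 1) _
        (fun ξ => by simp [symbol]),
      mulL2_eq_of_affine (α := 0) (β := ((2 - f : ℝ) : ℂ)) (i := 0) (j := 1) _
        (fun ξ => by simp [symbol]),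
      mulL2_eq_of_affine (α := 0) (β := 0) (i := 0) (j := 0) _ (fun ξ => by simp [symbol]),
      ← FourierTransform.fourier_add, ← FourierTransform.fourier_add]
    congr 1
    simp [boundedPart, opL1, matrixOp, Fin.sum_univ_three, -Complex.coe_smul]
    abel
  · rw [mulL2_eq_of_affine (α := 0) (β := f) (i := 1) (j := 2) _ (fun ξ => by simp [symbol]),
      mulL2_eq_of_affine (α := 0) (β := ((2 - f : ℝ) : ℂ)) (i := 0) (j := 2) _
        (fun ξ => by simp [symbol]),
      mulL2_eq_of_affine (α := 0) (β := 0) (i := 0) (j := 0) _ (fun ξ => by simp [symbol]),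
      ← FourierTransform.fourier_add, ← FourierTransform.fourier_add]
    congr 1
    simp [boundedPart, opL1, matrixOp, Fin.sum_univ_three, -Complex.coe_smul]
    abel

/-! ### Dissipativity -/

theorem re_inner_self {E : Type*} [NormedAddCommGroup E] [InnerProductSpace ℂ E] (u : E) :
    (inner ℂ u u).re = ‖u‖ ^ 2 :=
  inner_self_eq_norm_sq (𝕜 := ℂ) u

theorem re_inner_L2_eq_integral (u v : L2) :
    (inner ℂ u v).re = ∫ x, (inner ℂ (u x) (v x)).re := by
  rw [L2.inner_def]
  exact (Complex.reCLM.integral_comp_comm (L2.integrable_inner u v)).symm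

theorem coeFn_finsetSum {ι : Type*} [Fintype ι] (g : ι → L2) :
    ⇑(∑ i, g i) =ᵐ[volume] fun x => ∑ i, g i x := by
  classical
  suffices ∀ s : Finset ι, ⇑(∑ i ∈ s, g i) =ᵐ[volume] fun x => ∑ i ∈ s, g i x from this _
  intro s
  induction s using Finset.induction_on with
  | empty => exact Lp.coeFn_zero ℂ 2 volume
  | insert i s hi ih =>
    rw [Finset.sum_insert hi]
    filter_upwards [Lp.coeFn_add (g i) (∑ i ∈ s, g i), ih] with x h1 h2
    rw [h1, Pi.add_apply, h2, Finset.sum_insert hi]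

theorem integrable_re_inner (u v : L2) :
    Integrable (fun x => (inner ℂ (u x) (v x)).re) (volume : Measure R3) :=
  (L2.integrable_inner (𝕜 := ℂ) u v).re

theorem re_inner_L2Vec_eq_integral (U V : L2Vec) :
    (inner ℂ U V).re = ∫ x, (∑ i, inner ℂ (U i x) (V i x)).re := by
  simp only [PiLp.inner_apply, Complex.re_sum]
  rw [integral_finsetSum _ fun i _ => integrable_re_inner (U i) (V i)]
  exact Finset.sum_congr rfl fun i _ => re_inner_L2_eq_integral _ _

theorem re_inner_le_of_ae {U V U' V' : L2Vec}
    (h : ∀ᵐ x, (∑ i, inner ℂ (U i x) (V i x)).re ≤ (∑ i, inner ℂ (U' i x) (V' i x)).re) :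
    (inner ℂ U V).re ≤ (inner ℂ U' V').re := by
  rw [re_inner_L2Vec_eq_integral, re_inner_L2Vec_eq_integral]
  refine integral_mono_ae ?_ ?_ h
  · simp only [Complex.re_sum]
    exact integrable_finsetSum _ fun i _ => integrable_re_inner (U i) (V i)
  · simp only [Complex.re_sum]
    exact integrable_finsetSum _ fun i _ => integrable_re_inner (U' i) (V' i)

theorem inner_fourier_fourier (u v : L2) : inner ℂ (𝓕 u : L2) (𝓕 v : L2) = inner ℂ u v :=
  Lp.inner_fourier_eq u v

/-- The componentwise Fourier transform on `[L²(ℝ³)]³`. -/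
def fourierVec (u : L2Vec) : L2Vec := WithLp.toLp 2 fun i => 𝓕 (u i)

theorem inner_fourierVec (u v : L2Vec) : inner ℂ (fourierVec u) (fourierVec v) = inner ℂ u v := by
  simp only [PiLp.inner_apply]
  exact Finset.sum_congr rfl fun i _ => inner_fourier_fourier _ _

theorem re_inner_boundedPart_le {f : ℝ} (hf0 : 0 < f) (hf1 : f < 1) (u : L2Vec) :
    (inner ℂ u (boundedPart f u)).re ≤ upperRate f * ‖u‖ ^ 2 := by
  have h1 : upperRate f * ‖u‖ ^ 2 =
      (inner ℂ (fourierVec u) (((upperRate f : ℝ) : ℂ) • fourierVec u)).re := by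
    rw [inner_smul_right, Complex.re_ofReal_mul, inner_fourierVec, re_inner_self]
  rw [h1, ← inner_fourierVec]
  refine re_inner_le_of_ae ?_
  have hB : ∀ i, ∀ᵐ ξ, (𝓕 (boundedPart f u i) : L2) ξ =
      ∑ j, symbol f i j ξ * (𝓕 (u j) : L2) ξ := by
    intro i
    rw [fourier_boundedPart]
    have := fun j => coeFn_mulL2 _ (memLp_symbol f i j) (𝓕 (u j))
    filter_upwards [coeFn_finsetSum fun j => mulL2 _ (memLp_symbol f i j) (𝓕 (u j)),
      ae_all_iff.2 this] with ξ h1 h2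
    rw [h1]
    simp [h2]
  have hs : ∀ i, ∀ᵐ ξ, ((((upperRate f : ℝ) : ℂ) • (𝓕 (u i) : L2) : L2)) ξ =
      ((upperRate f : ℝ) : ℂ) * (𝓕 (u i) : L2) ξ := fun i => Lp.coeFn_smul _ _
  filter_upwards [ae_all_iff.2 hB, ae_all_iff.2 hs] with ξ hB hs
  simp only [fourierVec, PiLp.smul_apply, hB, hs]
  refine (re_symbol_le hf0 hf1 ξ _).trans_eq ?_
  rw [Finset.mul_sum, Complex.re_sum]
  refine Finset.sum_congr rfl fun i _ => ?_
  rw [← smul_eq_mul (a := ((upperRate f : ℝ) : ℂ)), inner_smul_right, Complex.re_ofReal_mul,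
    re_inner_self]

theorem toDist_laplacianL2 (u : laplacianL2.domain) :
    toDist (laplacianL2 u) = Δ (toDist u) := by
  exact (toDist_l2Realization _ u).trans (TemperedDistribution.laplacianCLM_apply _)

theorem toDist_yDx (u : yDx.domain) :
    toDist (yDx u) = TemperedDistribution.smulLeftCLM ℂ (fun p : R3 => ((p 1 : ℝ) : ℂ))
      (∂_{(EuclideanSpace.single 0 (1 : ℝ) : R3)} (toDist u)) :=
  toDist_l2Realization _ u

theorem re_inner_laplacianL2_nonpos (u : laplacianL2.domain) :
    (inner ℂ (u : L2) (laplacianL2 u)).re ≤ 0 := by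
  rw [← inner_fourier_fourier, re_inner_L2_eq_integral]
  refine integral_nonpos_of_ae ?_
  filter_upwards [toDist_eq_laplacian_iff.1 (toDist_laplacianL2 u)] with ξ hξ
  rw [hξ, ← smul_eq_mul, inner_smul_right, Complex.re_ofReal_mul, re_inner_self, neg_mul, neg_mul]
  exact neg_nonpos.2 (by positivity)

/-- Integration by parts for two functions whose derivatives `∂ᵢ` are square-integrable. -/
theorem inner_lineDeriv_eq_neg {u p w q : L2} (i : Fin 3)
    (hp : toDist p = ∂_{(EuclideanSpace.single i (1 : ℝ) : R3)} (toDist u))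
    (hq : toDist q = ∂_{(EuclideanSpace.single i (1 : ℝ) : R3)} (toDist w)) :
    inner ℂ p w = -inner ℂ u q := by
  rw [← inner_fourier_fourier p, ← inner_fourier_fourier u, L2.inner_def, L2.inner_def,
    ← integral_neg]
  refine integral_congr_ae ?_
  filter_upwards [(toDist_eq_lineDeriv_iff i).1 hp, (toDist_eq_lineDeriv_iff i).1 hq] with ξ h1 h2
  rw [h1, h2]
  simp only [RCLike.inner_apply, map_mul, Complex.conj_I, Complex.conj_ofReal, map_ofNat]
  ring

/-- If `u` and `Δ u` are square-integrable, then so is `∂ᵢ u`. -/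
theorem exists_toDist_eq_lineDeriv (u : laplacianL2.domain) (i : Fin 3) :
    ∃ p : L2, toDist p = ∂_{(EuclideanSpace.single i (1 : ℝ) : R3)} (toDist u) := by
  have hΔ := toDist_eq_laplacian_iff.1 (toDist_laplacianL2 u)
  have hmem : MemLp (fun ξ : R3 => (2 * Real.pi * Complex.I * ξ i) * (𝓕 (u : L2) : L2) ξ) 2
      (volume : Measure R3) := by
    refine (Lp.memLp (𝓕 (u : L2) - 𝓕 (laplacianL2 u) : L2)).of_le ?_ ?_
    · refine AEStronglyMeasurable.mul ?_ (Lp.aestronglyMeasurable _)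
      exact (Continuous.aestronglyMeasurable (by fun_prop))
    · filter_upwards [hΔ, Lp.coeFn_sub (𝓕 (u : L2) : L2) (𝓕 (laplacianL2 u))] with ξ h1 h2
      rw [h2, Pi.sub_apply, h1]
      have e : ∀ w : ℂ, w - ((-(2 * Real.pi) ^ 2 * ‖ξ‖ ^ 2 : ℝ) : ℂ) * w =
          ((1 + (2 * Real.pi * ‖ξ‖) ^ 2 : ℝ) : ℂ) * w := fun w => by push_cast; ring
      rw [e, norm_mul, norm_mul _ ((𝓕 (u : L2) : L2) ξ)]
      refine mul_le_mul_of_nonneg_right ?_ (norm_nonneg ((𝓕 (u : L2) : L2) ξ))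
      have hi : |ξ i| ≤ ‖ξ‖ := PiLp.norm_apply_le ξ i
      have hpi := Real.pi_pos
      rw [Complex.norm_real, Real.norm_of_nonneg (by positivity)]
      simp only [norm_mul, Complex.norm_real, Complex.norm_I, Complex.norm_ofNat, mul_one,
        Real.norm_eq_abs, abs_of_pos hpi]
      have : 2 * Real.pi * |ξ i| ≤ 2 * Real.pi * ‖ξ‖ := by gcongr
      nlinarith [sq_nonneg (2 * Real.pi * ‖ξ‖ - 1)]
  refine ⟨𝓕⁻ (hmem.toLp _), (toDist_eq_lineDeriv_iff i).2 ?_⟩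
  rw [fourier_fourierInv_eq]
  exact hmem.coeFn_toLp

theorem hasTemperateGrowth_inv_one_add_norm_sq {F : Type*} [NormedAddCommGroup F]
    [InnerProductSpace ℝ F] (T : R3 →L[ℝ] F) :
    (fun x : R3 => (((1 + ‖T x‖ ^ 2)⁻¹ : ℝ) : ℂ)).HasTemperateGrowth := by
  have h := (Function.hasTemperateGrowth_one_add_norm_sq_rpow F (-1)).comp T.hasTemperateGrowth
  have h2 := Function.HasTemperateGrowth.comp (g := Complex.ofReal)
    Function.Complex.hasTemperateGrowth_ofReal h
  simpa only [Function.comp_def, Real.rpow_neg_one] using h2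

/-- Multiplication by a function that is constant along `m` commutes with `∂ₘ`. -/
theorem lineDerivOp_smulLeftCLM_of_const {b : R3 → ℂ} (hb : b.HasTemperateGrowth) {m : R3}
    (hbm : ∀ (x : R3) (t : ℝ), b (x + t • m) = b x) (T : 𝓢'(R3, ℂ)) :
    ∂_{m} (TemperedDistribution.smulLeftCLM ℂ b T) =
      TemperedDistribution.smulLeftCLM ℂ b (∂_{m} T) := by
  ext φ
  simp only [TemperedDistribution.lineDerivOp_apply_apply,
    TemperedDistribution.smulLeftCLM_apply_apply]
  rw [map_neg]
  congr 2
  ext x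
  rw [SchwartzMap.smulLeftCLM_apply_apply hb, SchwartzMap.lineDerivOp_apply,
    SchwartzMap.lineDerivOp_apply, lineDeriv, lineDeriv, smul_eq_mul]
  simp only [SchwartzMap.smulLeftCLM_apply_apply hb, hbm, smul_eq_mul]
  exact (deriv_const_mul_field (b x)).symm

/-- The cutoff `1 / (1 + (y / (n + 1))²)`, written as a function of the norm of a linear map, the
form in which its temperate growth is known. -/
def cutoff (n : ℕ) (x : R3) : ℝ :=
  (1 + ‖((1 / (n + 1 : ℝ)) • (EuclideanSpace.proj (1 : Fin 3) : R3 →L[ℝ] ℝ)) x‖ ^ 2)⁻¹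

theorem cutoff_eq (n : ℕ) (x : R3) : cutoff n x = (1 + (x 1 / (n + 1)) ^ 2)⁻¹ := by
  simp [cutoff, div_eq_inv_mul, mul_pow]

theorem cutoff_le_one (n : ℕ) (x : R3) : cutoff n x ≤ 1 := by
  rw [cutoff_eq]
  exact inv_le_one_of_one_le₀ (by nlinarith [sq_nonneg (x 1 / (n + 1))])

theorem cutoff_nonneg (n : ℕ) (x : R3) : 0 ≤ cutoff n x := by
  rw [cutoff_eq]; positivity

theorem tendsto_cutoff (x : R3) :
    Filter.Tendsto (fun n => cutoff n x) Filter.atTop (nhds 1) := by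
  have h : Filter.Tendsto (fun n : ℕ => x 1 / ((n : ℝ) + 1)) Filter.atTop (nhds 0) :=
    Filter.Tendsto.div_atTop tendsto_const_nhds
      (Filter.tendsto_atTop_add_const_right _ _ tendsto_natCast_atTop_atTop)
  have h2 := ((h.pow 2).const_add 1).inv₀ (by norm_num)
  simpa [cutoff_eq] using h2

theorem hasTemperateGrowth_cutoff (n : ℕ) :
    (fun x : R3 => (cutoff n x : ℂ)).HasTemperateGrowth :=
  hasTemperateGrowth_inv_one_add_norm_sq _

theorem memLp_coord_mul_cutoff (n : ℕ) :
    MemLp (fun x : R3 => ((x 1 : ℝ) : ℂ) * (cutoff n x : ℂ)) ∞ (volume : Measure R3) := by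
  refine memLp_top_of_bound (C := n + 1) ?_ (Filter.Eventually.of_forall fun x => ?_)
  · exact ((hasTemperateGrowth_coord 1).mul
      (hasTemperateGrowth_cutoff n)).1.continuous.aestronglyMeasurable
  · have hn : (0 : ℝ) < n + 1 := by positivity
    rw [norm_mul, Complex.norm_real, Complex.norm_real, Real.norm_of_nonneg (cutoff_nonneg n x),
      cutoff_eq, ← div_eq_mul_inv, div_le_iff₀ (by positivity), Real.norm_eq_abs, ← sq_abs,
      abs_div, abs_of_pos hn]
    have : |x 1| = (|x 1| / (n + 1)) * (n + 1) := by field_simp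
    nlinarith [sq_nonneg (|x 1| / (n + 1) - 1), sq_nonneg (|x 1| / (n + 1))]

/-- The transport operator is skew-symmetric on the domain of the linearized operator. With the
unbounded coefficient `y` replaced by the bounded coefficient `y / (1 + (y / (n + 1))²)`, which is
still independent of `x`, this is an integration by parts. -/
theorem re_inner_yDx_eq_zero {u : L2} (h1 : u ∈ laplacianL2.domain) (h2 : u ∈ yDx.domain) :
    (inner ℂ u (yDx ⟨u, h2⟩)).re = 0 := by
  obtain ⟨p, hp⟩ := exists_toDist_eq_lineDeriv ⟨u, h1⟩ 0
  dsimp only at hp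
  have hv : yDx ⟨u, h2⟩ =ᵐ[volume] fun x => ((x 1 : ℝ) : ℂ) * p x :=
    ae_eq_of_toDist_eq_smulLeftCLM (hasTemperateGrowth_coord 1)
      ((toDist_yDx ⟨u, h2⟩).trans (by rw [hp]))
  have key : ∀ n : ℕ, ∫ x, cutoff n x * (inner ℂ (u x) (yDx ⟨u, h2⟩ x)).re = 0 := by
    intro n
    set b : R3 → ℂ := fun x => ((x 1 : ℝ) : ℂ) * (cutoff n x : ℂ) with hbdef
    have hb : b.HasTemperateGrowth :=
      (hasTemperateGrowth_coord 1).mul (hasTemperateGrowth_cutoff n)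
    have hbm := memLp_coord_mul_cutoff n
    have hw := coeFn_mulL2 b hbm u
    have hq := coeFn_mulL2 b hbm p
    have hder : toDist (mulL2 b hbm p) =
        ∂_{(EuclideanSpace.single 0 (1 : ℝ) : R3)} (toDist (mulL2 b hbm u)) := by
      rw [toDist_eq_smulLeftCLM_of_ae hb hw, toDist_eq_smulLeftCLM_of_ae hb hq, hp,
        lineDerivOp_smulLeftCLM_of_const hb]
      intro x t
      simp [hbdef, cutoff_eq]
    have hskew := inner_lineDeriv_eq_neg 0 hp hder
    have hsymm : inner ℂ p (mulL2 b hbm u) = inner ℂ (mulL2 b hbm p) u := by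
      rw [L2.inner_def, L2.inner_def]
      refine integral_congr_ae ?_
      filter_upwards [hw, hq] with x hw hq
      rw [hw, hq]
      simp only [hbdef, RCLike.inner_apply, map_mul, Complex.conj_ofReal]
      ring
    have hre : (inner ℂ u (mulL2 b hbm p)).re = 0 := by
      have := congrArg Complex.re (hsymm.symm.trans hskew)
      rw [← inner_conj_symm, Complex.conj_re, Complex.neg_re] at this
      linarith
    rw [re_inner_L2_eq_integral] at hre
    rw [← hre]
    refine integral_congr_ae ?_
    filter_upwards [hv, hq] with x hv hq
    rw [hv, hq, ← Complex.re_ofReal_mul, ← inner_smul_right, smul_eq_mul]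
    congr 2
    simp only [hbdef]
    ring
  have hlim : Filter.Tendsto (fun n : ℕ => ∫ x, cutoff n x * (inner ℂ (u x) (yDx ⟨u, h2⟩ x)).re)
      Filter.atTop (nhds (∫ x, (inner ℂ (u x) (yDx ⟨u, h2⟩ x)).re)) := by
    have hint := integrable_re_inner u (yDx ⟨u, h2⟩)
    refine tendsto_integral_of_dominated_convergence
      (fun x => ‖(inner ℂ (u x) (yDx ⟨u, h2⟩ x)).re‖) (fun n => ?_) hint.norm (fun n => ?_) ?_
    · refine AEStronglyMeasurable.mul ?_ hint.aestronglyMeasurable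
      exact (Complex.continuous_re.comp
        (hasTemperateGrowth_cutoff n).1.continuous).aestronglyMeasurable
    · refine Filter.Eventually.of_forall fun x => ?_
      rw [norm_mul, Real.norm_of_nonneg (cutoff_nonneg n x)]
      exact mul_le_of_le_one_left (norm_nonneg _) (cutoff_le_one n x)
    · refine Filter.Eventually.of_forall fun x => ?_
      simpa using (tendsto_cutoff x).mul_const ((inner ℂ (u x) (yDx ⟨u, h2⟩ x)).re)
  rw [re_inner_L2_eq_integral]
  refine tendsto_nhds_unique hlim ?_
  simp only [key]
  exact tendsto_const_nhds

/-- `𝓛 - Λ̄` is dissipative. -/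
theorem re_inner_linearizedOp_le {ν f : ℝ} (hν : 0 < ν) (hf0 : 0 < f) (hf1 : f < 1)
    (u : (linearizedOp ν f).domain) :
    (inner ℂ (u : L2Vec) (linearizedOp ν f u)).re ≤ upperRate f * ‖(u : L2Vec)‖ ^ 2 := by
  refine le_trans ?_ (re_inner_boundedPart_le hf0 hf1 (u : L2Vec))
  simp only [PiLp.inner_apply, Complex.re_sum]
  refine Finset.sum_le_sum fun i _ => ?_
  rw [linearizedOp_apply, inner_sub_right, inner_add_right, inner_smul_right, Complex.sub_re,
    Complex.add_re, Complex.re_ofReal_mul, re_inner_yDx_eq_zero (u.2.1 i)]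
  have := mul_nonpos_of_nonneg_of_nonpos hν.le
    (re_inner_laplacianL2_nonpos ⟨(u : L2Vec) i, u.2.1 i⟩)
  linarith

/-! ### Existence of weak solutions -/

/-- Lions' form of the Riesz representation theorem: a functional that is bounded in terms of
`‖Φ v‖` is represented by a vector tested against `Φ v`. -/
theorem exists_inner_apply_eq {V H : Type*} [AddCommGroup V] [Module ℂ V] [NormedAddCommGroup H]
    [InnerProductSpace ℂ H] [CompleteSpace H] (Φ : V →ₗ[ℂ] H) (l : V →ₗ[ℂ] ℂ) (C : ℝ)
    (h : ∀ v, ‖l v‖ ≤ C * ‖Φ v‖) : ∃ w : H, ∀ v, inner ℂ w (Φ v) = l v := by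
  have hker : LinearMap.ker Φ ≤ LinearMap.ker l := fun v hv => by
    have := h v
    rw [LinearMap.mem_ker.1 hv, norm_zero, mul_zero] at this
    exact LinearMap.mem_ker.2 (norm_le_zero_iff.1 this)
  let l' : LinearMap.range Φ →ₗ[ℂ] ℂ :=
    (LinearMap.ker Φ).liftQ l hker ∘ₗ Φ.quotKerEquivRange.symm.toLinearMap
  have hl' : ∀ v, l' ⟨Φ v, v, rfl⟩ = l v := fun v => by
    have : Φ.quotKerEquivRange.symm ⟨Φ v, v, rfl⟩ = (LinearMap.ker Φ).mkQ v :=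
      (LinearEquiv.symm_apply_eq _).2 rfl
    simp only [l', LinearMap.comp_apply, LinearEquiv.coe_coe, this]
    rfl
  let L : LinearMap.range Φ →L[ℂ] ℂ := l'.mkContinuous C (by
    rintro ⟨_, v, rfl⟩
    rw [hl']
    exact h v)
  obtain ⟨G, hG, -⟩ := exists_extension_norm_eq _ L
  refine ⟨(InnerProductSpace.toDual ℂ H).symm G, fun v => ?_⟩
  rw [InnerProductSpace.toDual_symm_apply]
  exact (hG ⟨Φ v, v, rfl⟩).trans (hl' v)

/-- The weight `1 / (1 + κ|ξ|²)` on the Fourier side, for `κ > 0`, written as a function of the norm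
of a linear map, the form in which its temperate growth is known. -/
def weight (κ : ℝ) (ξ : R3) : ℝ :=
  (1 + ‖(√κ • ContinuousLinearMap.id ℝ R3) ξ‖ ^ 2)⁻¹

theorem weight_eq {κ : ℝ} (hκ : 0 < κ) (ξ : R3) : weight κ ξ = (1 + κ * ‖ξ‖ ^ 2)⁻¹ := by
  simp [weight, norm_smul, mul_pow, Real.sq_sqrt hκ.le]

theorem hasTemperateGrowth_weight (κ : ℝ) : (fun ξ : R3 => (weight κ ξ : ℂ)).HasTemperateGrowth :=
  hasTemperateGrowth_inv_one_add_norm_sq _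

theorem weight_pos (κ : ℝ) (ξ : R3) : 0 < weight κ ξ := by
  unfold weight; positivity

theorem weight_le_one (κ : ℝ) (ξ : R3) : weight κ ξ ≤ 1 :=
  inv_le_one_of_one_le₀ (by simp)

theorem memLp_weight (κ : ℝ) : MemLp (fun ξ : R3 => (weight κ ξ : ℂ)) ∞ (volume : Measure R3) := by
  refine memLp_top_of_bound (C := 1)
    (hasTemperateGrowth_weight κ).1.continuous.aestronglyMeasurable
    (Filter.Eventually.of_forall fun ξ => ?_)
  rw [Complex.norm_real, Real.norm_of_nonneg (weight_pos κ ξ).le]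
  exact weight_le_one κ ξ

theorem hasDerivAt_weight {κ : ℝ} (hκ : 0 < κ) (ξ : R3) :
    HasDerivAt (fun t : ℝ => weight κ (ξ + t • EuclideanSpace.single 1 (1 : ℝ)))
      (-(2 * κ * ξ 1 * weight κ ξ ^ 2)) 0 := by
  have h1 : ∀ t : ℝ, weight κ (ξ + t • EuclideanSpace.single 1 (1 : ℝ)) =
      (1 + κ * (‖ξ‖ ^ 2 + 2 * ξ 1 * t + t ^ 2))⁻¹ := fun t => by
    rw [weight_eq hκ, EuclideanSpace.real_norm_sq_eq, EuclideanSpace.real_norm_sq_eq,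
      Fin.sum_univ_three, Fin.sum_univ_three]
    congr 3
    simp
    ring
  simp only [h1]
  have h2 : HasDerivAt (fun t : ℝ => 1 + κ * (‖ξ‖ ^ 2 + 2 * ξ 1 * t + t ^ 2))
      (κ * (2 * ξ 1)) 0 := by
    have := ((((hasDerivAt_id (0 : ℝ)).const_mul (2 * ξ 1)).const_add (‖ξ‖ ^ 2)).add
      ((hasDerivAt_id (0 : ℝ)).pow 2)).const_mul κ |>.const_add 1
    simpa using this
  have hpos : 1 + κ * ‖ξ‖ ^ 2 ≠ 0 := by positivity
  refine (h2.inv (by simpa using hpos)).congr_deriv ?_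
  rw [weight_eq hκ]
  simp
  field_simp

/-- Integration by parts in the transport term: its real part against the weighted function is
the commutator of the transport field with the weight. -/
theorem re_integral_transport {κ : ℝ} (hκ : 0 < κ) (φ : 𝓢(R3, ℂ)) :
    (inner ℂ (φ.toLp 2 : L2) ((SchwartzMap.smulLeftCLM ℂ (fun ξ : R3 => (weight κ ξ : ℂ))
      (SchwartzMap.smulLeftCLM ℂ (fun ξ : R3 => ((ξ 0 : ℝ) : ℂ))
        (∂_{(EuclideanSpace.single 1 (1 : ℝ) : R3)} φ))).toLp 2)).re =
    ∫ ξ, κ * ξ 0 * ξ 1 * weight κ ξ ^ 2 * ‖φ ξ‖ ^ 2 := by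
  have hm := hasTemperateGrowth_weight κ
  have h0 := hasTemperateGrowth_coord 0
  set e : R3 := EuclideanSpace.single 1 (1 : ℝ) with he
  rw [SchwartzMap.inner_toL2_toL2_eq _ _ volume]
  simp only [SchwartzMap.smulLeftCLM_apply_apply hm, SchwartzMap.smulLeftCLM_apply_apply h0,
    smul_eq_mul]
  -- `a` is the conjugate of `φ` times the weighted coefficient `ξ₀` of the transport field
  let cφ : 𝓢(R3, ℂ) := SchwartzMap.postcompCLM (𝕜 := ℝ) (Complex.conjCLE : ℂ →L[ℝ] ℂ) φ
  let a : 𝓢(R3, ℂ) := SchwartzMap.smulLeftCLM ℂ (fun ξ : R3 => (weight κ ξ : ℂ))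
    (SchwartzMap.smulLeftCLM ℂ (fun ξ : R3 => ((ξ 0 : ℝ) : ℂ)) cφ)
  have ha : ∀ ξ, a ξ = (weight κ ξ : ℂ) * (((ξ 0 : ℝ) : ℂ) * starRingEnd ℂ (φ ξ)) := fun ξ => by
    simp only [a, SchwartzMap.smulLeftCLM_apply_apply hm, SchwartzMap.smulLeftCLM_apply_apply h0,
      smul_eq_mul]
    rfl
  have hφ : ∀ ξ, HasDerivAt (fun t : ℝ => φ (ξ + t • e)) (∂_{e} φ ξ) 0 := fun ξ => by
    rw [SchwartzMap.lineDerivOp_apply]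
    exact (φ.differentiableAt.lineDifferentiableAt).hasLineDerivAt
  have hda : ∀ ξ, ∂_{e} a ξ = ((ξ 0 : ℝ) : ℂ) *
      (((-(2 * κ * ξ 1 * weight κ ξ ^ 2) : ℝ) : ℂ) * starRingEnd ℂ (φ ξ)
        + (weight κ ξ : ℂ) * starRingEnd ℂ (∂_{e} φ ξ)) := fun ξ => by
    rw [SchwartzMap.lineDerivOp_apply]
    have hc : HasDerivAt (fun t : ℝ => starRingEnd ℂ (φ (ξ + t • e)))
        (starRingEnd ℂ (∂_{e} φ ξ)) 0 := (hφ ξ).star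
    have hw : HasDerivAt (fun t : ℝ => (weight κ (ξ + t • e) : ℂ)) _ 0 :=
      (hasDerivAt_weight hκ ξ).ofReal_comp
    have := (hw.mul hc).const_mul ((ξ 0 : ℝ) : ℂ)
    have h2 : (fun t : ℝ => a (ξ + t • e)) = fun t : ℝ => ((ξ 0 : ℝ) : ℂ) *
        ((weight κ (ξ + t • e) : ℂ) * starRingEnd ℂ (φ (ξ + t • e))) := by
      funext t
      rw [ha]
      simp [he]
      ring
    rw [lineDeriv, h2]
    refine this.deriv.trans ?_
    simp
  have hparts := SchwartzMap.integral_mul_lineDerivOp_right_eq_neg_left (μ := volume) a φ e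
  have hint1 : Integrable (fun ξ => a ξ * ∂_{e} φ ξ) (volume : Measure R3) :=
    (SchwartzMap.pairing (ContinuousLinearMap.mul ℂ ℂ) a (∂_{e} φ)).integrable
  have hint2 : Integrable (fun ξ => ∂_{e} a ξ * φ ξ) (volume : Measure R3) :=
    (SchwartzMap.pairing (ContinuousLinearMap.mul ℂ ℂ) (∂_{e} a) φ).integrable
  have hZ : ∀ ξ, inner ℂ (φ ξ) ((weight κ ξ : ℂ) * (((ξ 0 : ℝ) : ℂ) * ∂_{e} φ ξ)) =
      a ξ * ∂_{e} φ ξ := fun ξ => by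
    rw [ha, RCLike.inner_apply]
    ring
  simp only [hZ]
  have hre1 : (∫ ξ, a ξ * ∂_{e} φ ξ).re = ∫ ξ, (a ξ * ∂_{e} φ ξ).re :=
    (Complex.reCLM.integral_comp_comm hint1).symm
  have hre2 : (∫ ξ, ∂_{e} a ξ * φ ξ).re = ∫ ξ, (∂_{e} a ξ * φ ξ).re :=
    (Complex.reCLM.integral_comp_comm hint2).symm
  have hsum : ∫ ξ, κ * ξ 0 * ξ 1 * weight κ ξ ^ 2 * ‖φ ξ‖ ^ 2 =
      ∫ ξ, (1 / 2 * (a ξ * ∂_{e} φ ξ).re - 1 / 2 * (∂_{e} a ξ * φ ξ).re) := by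
    refine integral_congr_ae (Filter.Eventually.of_forall fun ξ => ?_)
    simp only [ha, hda, Complex.sq_norm, Complex.normSq_apply]
    simp [sq]
    ring
  have hi1 : Integrable (fun ξ => (a ξ * ∂_{e} φ ξ).re) (volume : Measure R3) := hint1.re
  have hi2 : Integrable (fun ξ => (∂_{e} a ξ * φ ξ).re) (volume : Measure R3) := hint2.re
  rw [hsum, integral_sub (hi1.const_mul _) (hi2.const_mul _), integral_const_mul,
    integral_const_mul, ← hre1, ← hre2, hparts, Complex.neg_re]
  ring

/-- The scalar part `φ ↦ (z + κ|ξ|²) φ + ξ₀ ∂₁ φ` of the transposed operator on the Fourier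
side. -/
def transposeCLM (z : ℂ) (κ : ℝ) : 𝓢(R3, ℂ) →L[ℂ] 𝓢(R3, ℂ) :=
  SchwartzMap.smulLeftCLM ℂ (fun ξ : R3 => z + ((κ * ‖ξ‖ ^ 2 : ℝ) : ℂ)) +
    SchwartzMap.smulLeftCLM ℂ (fun ξ : R3 => ((ξ 0 : ℝ) : ℂ)) ∘L
      lineDerivOpCLM ℂ 𝓢(R3, ℂ) (EuclideanSpace.single 1 (1 : ℝ) : R3)

theorem hasTemperateGrowth_add_normSq (z : ℂ) (κ : ℝ) :
    (fun ξ : R3 => z + ((κ * ‖ξ‖ ^ 2 : ℝ) : ℂ)).HasTemperateGrowth := by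
  fun_prop

/-- Multiplication of a Schwartz function by the weight, as a map to `L²(ℝ³)`. -/
def weightCLM (κ : ℝ) : 𝓢(R3, ℂ) →L[ℂ] L2 :=
  SchwartzMap.toLpCLM ℂ ℂ 2 volume ∘L SchwartzMap.smulLeftCLM ℂ (fun ξ : R3 => (weight κ ξ : ℂ))

theorem coeFn_weightCLM (κ : ℝ) (φ : 𝓢(R3, ℂ)) :
    weightCLM κ φ =ᵐ[volume] fun ξ => (weight κ ξ : ℂ) * φ ξ := by
  filter_upwards [SchwartzMap.coeFn_toLp (SchwartzMap.smulLeftCLM ℂ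
    (fun ξ : R3 => (weight κ ξ : ℂ)) φ) 2 volume] with ξ h
  refine h.trans ?_
  rw [SchwartzMap.smulLeftCLM_apply_apply (hasTemperateGrowth_weight κ), smul_eq_mul]

/-- The transpose of `z - 𝓛` on the Fourier side, multiplied by the weight, on vectors of Schwartz
functions. -/
def testMap (f : ℝ) (z : ℂ) (κ : ℝ) : (Fin 3 → 𝓢(R3, ℂ)) →ₗ[ℂ] L2Vec where
  toFun φ := WithLp.toLp 2 fun j => weightCLM κ (transposeCLM z κ (φ j))
    - ∑ i, mulL2 (symbol f i j) (memLp_symbol f i j) (weightCLM κ (φ i))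
  map_add' φ ψ := by
    ext1 j
    simp only [Pi.add_apply, map_add, Finset.sum_add_distrib, PiLp.add_apply]
    abel
  map_smul' c φ := by
    ext1 j
    simp only [Pi.smul_apply, map_smul, PiLp.smul_apply, RingHom.id_apply, smul_sub,
      Finset.smul_sum]

/-- A vector of Schwartz functions as an element of `[L²(ℝ³)]³`. -/
def schwartzVec (φ : Fin 3 → 𝓢(R3, ℂ)) : L2Vec := WithLp.toLp 2 fun j => (φ j).toLp 2

/-- The commutator term `κ ξ₀ ξ₁ m²` is at most half of the diffusion term `κ|ξ|² m`. -/
theorem weight_estimate {κ δ : ℝ} (hκ : 0 < κ) (ξ : R3) :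
    min δ (1 / 2) ≤ weight κ ξ * (δ + κ * ‖ξ‖ ^ 2) + κ * ξ 0 * ξ 1 * weight κ ξ ^ 2 := by
  have hm := weight_pos κ ξ
  have hm1 : weight κ ξ * (1 + κ * ‖ξ‖ ^ 2) = 1 := by
    rw [weight_eq hκ]
    exact inv_mul_cancel₀ (by positivity)
  have hsq : ‖ξ‖ ^ 2 = ξ 0 ^ 2 + ξ 1 ^ 2 + ξ 2 ^ 2 := by
    rw [EuclideanSpace.real_norm_sq_eq, Fin.sum_univ_three]
  have h1 : -(‖ξ‖ ^ 2 / 2) ≤ ξ 0 * ξ 1 := by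
    nlinarith [sq_nonneg (ξ 0 + ξ 1), sq_nonneg (ξ 2)]
  have h2 : -(κ * ‖ξ‖ ^ 2 / 2 * weight κ ξ) ≤ κ * ξ 0 * ξ 1 * weight κ ξ ^ 2 := by
    have e1 : κ * weight κ ξ ^ 2 * -(‖ξ‖ ^ 2 / 2) ≤ κ * weight κ ξ ^ 2 * (ξ 0 * ξ 1) :=
      mul_le_mul_of_nonneg_left h1 (by positivity)
    have e2 : weight κ ξ ^ 2 * (κ * ‖ξ‖ ^ 2) ≤ weight κ ξ * (κ * ‖ξ‖ ^ 2) :=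
      mul_le_mul_of_nonneg_right (by nlinarith [weight_le_one κ ξ]) (by positivity)
    linarith
  have h3 : min δ (1 / 2) * 1 ≤ δ + κ * ‖ξ‖ ^ 2 / 2 - min δ (1 / 2) * (κ * ‖ξ‖ ^ 2) := by
    have e3 := mul_le_mul_of_nonneg_right (min_le_right δ (1 / 2))
      (show 0 ≤ κ * ‖ξ‖ ^ 2 by positivity)
    linarith [min_le_left δ (1 / 2)]
  have h4 : weight κ ξ * (min δ (1 / 2) * (1 + κ * ‖ξ‖ ^ 2)) ≤
      weight κ ξ * (δ + κ * ‖ξ‖ ^ 2 / 2) :=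
    mul_le_mul_of_nonneg_left (by linarith) hm.le
  have h5 : weight κ ξ * (min δ (1 / 2) * (1 + κ * ‖ξ‖ ^ 2)) = min δ (1 / 2) := by
    rw [mul_left_comm, hm1, mul_one]
  linarith

theorem coercive_testMap {f κ : ℝ} (hf0 : 0 < f) (hf1 : f < 1) (hκ : 0 < κ) (z : ℂ)
    (φ : Fin 3 → 𝓢(R3, ℂ)) :
    min (z.re - upperRate f) (1 / 2) * ‖schwartzVec φ‖ ^ 2 ≤
      (inner ℂ (schwartzVec φ) (testMap f z κ φ)).re := by
  have hm := hasTemperateGrowth_weight κ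
  have hr : (fun ξ : R3 => (κ : ℂ) * ((ξ 0 : ℝ) : ℂ) * ((ξ 1 : ℝ) : ℂ) *
      (weight κ ξ : ℂ) ^ 2).HasTemperateGrowth :=
    (((Function.HasTemperateGrowth.const _).mul (hasTemperateGrowth_coord 0)).mul
      (hasTemperateGrowth_coord 1)).mul (hm.pow 2)
  -- the commutator `r` may take the place of the transport term under the real part
  let r : Fin 3 → 𝓢(R3, ℂ) := fun j => SchwartzMap.smulLeftCLM ℂ
    (fun ξ : R3 => (κ : ℂ) * ((ξ 0 : ℝ) : ℂ) * ((ξ 1 : ℝ) : ℂ) * (weight κ ξ : ℂ) ^ 2) (φ j)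
  let ψ : Fin 3 → 𝓢(R3, ℂ) := fun j =>
    SchwartzMap.smulLeftCLM ℂ (fun ξ : R3 => z + ((κ * ‖ξ‖ ^ 2 : ℝ) : ℂ)) (φ j)
  let V : L2Vec := WithLp.toLp 2 fun j => weightCLM κ (ψ j) + (r j).toLp 2 volume
    - ∑ i, mulL2 (symbol f i j) (memLp_symbol f i j) (weightCLM κ (φ i))
  have hrepl : (inner ℂ (schwartzVec φ) (testMap f z κ φ)).re =
      (inner ℂ (schwartzVec φ) V).re := by
    simp only [PiLp.inner_apply, Complex.re_sum]
    refine Finset.sum_congr rfl fun j _ => ?_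
    simp only [testMap, V, schwartzVec, LinearMap.coe_mk, AddHom.coe_mk]
    have hsplit : weightCLM κ (transposeCLM z κ (φ j)) = weightCLM κ (ψ j) +
        (SchwartzMap.smulLeftCLM ℂ (fun ξ : R3 => (weight κ ξ : ℂ))
          (SchwartzMap.smulLeftCLM ℂ (fun ξ : R3 => ((ξ 0 : ℝ) : ℂ))
            (∂_{(EuclideanSpace.single 1 (1 : ℝ) : R3)} (φ j)))).toLp 2 volume :=
      (weightCLM κ).map_add _ _
    rw [hsplit, inner_sub_right, inner_add_right, inner_sub_right, inner_add_right,
      Complex.sub_re, Complex.add_re, Complex.sub_re, Complex.add_re, re_integral_transport hκ]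
    congr 2
    rw [re_inner_L2_eq_integral]
    refine integral_congr_ae ?_
    filter_upwards [(φ j).coeFn_toLp 2 volume, (r j).coeFn_toLp 2 volume] with ξ h1 h2
    rw [h1, h2]
    simp only [r, SchwartzMap.smulLeftCLM_apply_apply hr]
    have hcast : (κ : ℂ) * ((ξ 0 : ℝ) : ℂ) * ((ξ 1 : ℝ) : ℂ) * (weight κ ξ : ℂ) ^ 2 =
        ((κ * ξ 0 * ξ 1 * weight κ ξ ^ 2 : ℝ) : ℂ) := by push_cast; rfl
    rw [inner_smul_right, hcast, Complex.re_ofReal_mul, re_inner_self]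
  have hself : min (z.re - upperRate f) (1 / 2) * ‖schwartzVec φ‖ ^ 2 = (inner ℂ (schwartzVec φ)
      (((min (z.re - upperRate f) (1 / 2) : ℝ) : ℂ) • schwartzVec φ)).re := by
    rw [inner_smul_right, Complex.re_ofReal_mul, re_inner_self]
  rw [hrepl, hself]
  refine re_inner_le_of_ae ?_
  have h1 : ∀ᵐ ξ, ∀ j, schwartzVec φ j ξ = φ j ξ :=
    ae_all_iff.2 fun j => (φ j).coeFn_toLp 2 volume
  have h2 : ∀ᵐ ξ, ∀ j, (((min (z.re - upperRate f) (1 / 2) : ℝ) : ℂ) • schwartzVec φ) j ξ =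
      ((min (z.re - upperRate f) (1 / 2) : ℝ) : ℂ) • schwartzVec φ j ξ :=
    ae_all_iff.2 fun j => Lp.coeFn_smul _ (schwartzVec φ j)
  have h3 : ∀ᵐ ξ, ∀ j, V j ξ = ((weight κ ξ : ℂ) * (z + ((κ * ‖ξ‖ ^ 2 : ℝ) : ℂ)) +
      ((κ * ξ 0 * ξ 1 * weight κ ξ ^ 2 : ℝ) : ℂ)) • φ j ξ -
      (weight κ ξ : ℂ) • ∑ i, symbol f i j ξ * φ i ξ := by
    refine ae_all_iff.2 fun j => ?_
    have h4 := fun i => coeFn_mulL2 _ (memLp_symbol f i j) (weightCLM κ (φ i))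
    have h5 := fun i => coeFn_weightCLM κ (φ i)
    filter_upwards [ae_all_iff.2 h4, ae_all_iff.2 h5, coeFn_weightCLM κ (ψ j),
      (r j).coeFn_toLp 2 volume,
      coeFn_finsetSum fun i => mulL2 _ (memLp_symbol f i j) (weightCLM κ (φ i)),
      Lp.coeFn_add (weightCLM κ (ψ j)) ((r j).toLp 2 volume),
      Lp.coeFn_sub (weightCLM κ (ψ j) + (r j).toLp 2 volume)
        (∑ i, mulL2 _ (memLp_symbol f i j) (weightCLM κ (φ i)))] with ξ h4 h5 h6 h7 h8 h9 h10
    refine h10.trans ?_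
    rw [Pi.sub_apply, h9, Pi.add_apply, h6, h7, h8]
    simp only [h4, h5, ψ, r, SchwartzMap.smulLeftCLM_apply_apply hr,
      SchwartzMap.smulLeftCLM_apply_apply (hasTemperateGrowth_add_normSq z κ), smul_eq_mul,
      Finset.mul_sum]
    push_cast
    congr 1
    · ring
    · exact Finset.sum_congr rfl fun i _ => by ring
  filter_upwards [h1, h2, h3] with ξ h1 h2 h3
  simp only [h2, h3, h1, inner_sub_right, inner_smul_right, Finset.sum_sub_distrib,
    ← Finset.mul_sum]
  have hsum : ∑ i, inner ℂ (φ i ξ) (φ i ξ) = ((∑ i, ‖φ i ξ‖ ^ 2 : ℝ) : ℂ) := by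
    push_cast
    exact Finset.sum_congr rfl fun i _ => inner_self_eq_norm_sq_to_K _
  have hB := (re_symbol_transpose_eq f ξ fun i => φ i ξ).trans_le
    (re_symbol_le hf0 hf1 ξ fun i => φ i ξ)
  have hw := mul_le_mul_of_nonneg_right (weight_estimate (δ := z.re - upperRate f) hκ ξ)
    (show 0 ≤ ∑ i, ‖φ i ξ‖ ^ 2 by positivity)
  have hB' := mul_le_mul_of_nonneg_left hB (weight_pos κ ξ).le
  rw [hsum, ← Complex.ofReal_mul, Complex.ofReal_re, Complex.sub_re, Complex.re_mul_ofReal,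
    Complex.re_ofReal_mul, Complex.add_re, Complex.re_ofReal_mul, Complex.ofReal_re,
    Complex.add_re, Complex.ofReal_re]
  linarith

theorem norm_schwartzVec_le {f κ : ℝ} (hf0 : 0 < f) (hf1 : f < 1) (hκ : 0 < κ) {z : ℂ}
    (hz : upperRate f < z.re) (φ : Fin 3 → 𝓢(R3, ℂ)) :
    ‖schwartzVec φ‖ ≤ (min (z.re - upperRate f) (1 / 2))⁻¹ * ‖testMap f z κ φ‖ := by
  have hc : 0 < min (z.re - upperRate f) (1 / 2) := lt_min (by linarith) (by norm_num)
  have h := coercive_testMap hf0 hf1 hκ z φ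
  have h2 := (Complex.re_le_norm _).trans (norm_inner_le_norm (𝕜 := ℂ) (schwartzVec φ)
    (testMap f z κ φ))
  rw [inv_mul_eq_div, le_div_iff₀ hc]
  obtain h0 | h0 := (norm_nonneg (schwartzVec φ)).eq_or_lt
  · rw [← h0, zero_mul]; exact norm_nonneg _
  · refine le_of_mul_le_mul_left ?_ h0
    linarith

theorem inner_star_toLp (h : L2) (φ : 𝓢(R3, ℂ)) :
    inner ℂ (star h) (φ.toLp 2 : L2) = toDist h φ := by
  rw [L2.inner_def, toDist_apply]
  refine integral_congr_ae ?_
  filter_upwards [Lp.coeFn_star h, φ.coeFn_toLp 2 volume] with x h1 h2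
  rw [h1, h2, RCLike.inner_apply]
  simp

/-- Existence on the Fourier side, in the sense of distributions: the equation has a solution `U`
that is the weight times a square-integrable function. -/
theorem exists_weak_solution {f κ : ℝ} (hf0 : 0 < f) (hf1 : f < 1) (hκ : 0 < κ) {z : ℂ}
    (hz : upperRate f < z.re) (g : L2Vec) :
    ∃ w U : L2Vec, (∀ i, U i =ᵐ[volume] fun ξ => (weight κ ξ : ℂ) * w i ξ) ∧
      ∀ i (ψ : 𝓢(R3, ℂ)), toDist (U i) (transposeCLM z κ ψ) =
        toDist (∑ j, mulL2 (symbol f i j) (memLp_symbol f i j) (U j)) ψ + toDist (g i) ψ := by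
  let l : (Fin 3 → 𝓢(R3, ℂ)) →ₗ[ℂ] ℂ :=
    { toFun := fun φ => ∑ j, toDist (g j) (φ j)
      map_add' := fun φ ψ => by simp [Finset.sum_add_distrib]
      map_smul' := fun c φ => by simp [Finset.mul_sum] }
  let g' : L2Vec := WithLp.toLp 2 fun j => star (g j)
  have hl : ∀ φ, l φ = inner ℂ g' (schwartzVec φ) := fun φ => by
    simp only [PiLp.inner_apply, l, LinearMap.coe_mk, AddHom.coe_mk]
    exact Finset.sum_congr rfl fun j _ => (inner_star_toLp (g j) (φ j)).symm
  -- `w` is tested sesquilinearly, distributions bilinearly: the solution is the conjugate of `w`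
  obtain ⟨w, hw⟩ := exists_inner_apply_eq (testMap f z κ) l
    (‖g'‖ * (min (z.re - upperRate f) (1 / 2))⁻¹) fun φ => by
      rw [hl, mul_assoc]
      exact (norm_inner_le_norm _ _).trans
        (mul_le_mul_of_nonneg_left (norm_schwartzVec_le hf0 hf1 hκ hz φ) (norm_nonneg _))
  let U : L2Vec := WithLp.toLp 2 fun j =>
    mulL2 (fun ξ => (weight κ ξ : ℂ)) (memLp_weight κ) (star (w j))
  have hU : ∀ i, U i =ᵐ[volume] fun ξ => (weight κ ξ : ℂ) * (star (w i) : L2) ξ := fun i =>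
    coeFn_mulL2 _ _ _
  have hdiag : ∀ i χ, inner ℂ (w i) (weightCLM κ χ) = toDist (U i) χ := fun i χ => by
    rw [L2.inner_def, toDist_apply]
    refine integral_congr_ae ?_
    filter_upwards [hU i, coeFn_weightCLM κ χ, Lp.coeFn_star (w i)] with ξ h1 h2 h3
    rw [h1, h2, h3, RCLike.inner_apply]
    simp
    ring
  have hoff : ∀ i j χ, inner ℂ (w j) (mulL2 (symbol f i j) (memLp_symbol f i j) (weightCLM κ χ)) =
      toDist (mulL2 (symbol f i j) (memLp_symbol f i j) (U j)) χ := fun i j χ => by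
    rw [L2.inner_def, toDist_apply]
    refine integral_congr_ae ?_
    filter_upwards [hU j, coeFn_weightCLM κ χ, Lp.coeFn_star (w j),
      coeFn_mulL2 _ (memLp_symbol f i j) (weightCLM κ χ),
      coeFn_mulL2 _ (memLp_symbol f i j) (U j)] with ξ h1 h2 h3 h4 h5
    rw [h4, h5, h1, h2, h3, RCLike.inner_apply]
    simp
    ring
  refine ⟨WithLp.toLp 2 fun j => star (w j), U, hU, fun i ψ => ?_⟩
  have h := hw (Pi.single i ψ)
  have hl' : l (Pi.single i ψ) = toDist (g i) ψ := by
    simp only [l, LinearMap.coe_mk, AddHom.coe_mk]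
    rw [Finset.sum_eq_single i]
    · simp
    · intro j _ hj
      simp [hj]
    · simp
  have hΦ : inner ℂ w (testMap f z κ (Pi.single i ψ)) = toDist (U i) (transposeCLM z κ ψ) -
      toDist (∑ j, mulL2 (symbol f i j) (memLp_symbol f i j) (U j)) ψ := by
    have hs : ∀ j, ∑ k, mulL2 (symbol f k j) (memLp_symbol f k j)
        (weightCLM κ ((Pi.single i ψ : Fin 3 → 𝓢(R3, ℂ)) k)) =
        mulL2 (symbol f i j) (memLp_symbol f i j) (weightCLM κ ψ) := fun j => by
      rw [Finset.sum_eq_single i]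
      · simp
      · intro k _ hk
        simp [hk]
      · simp
    rw [PiLp.inner_apply]
    simp only [testMap, LinearMap.coe_mk, AddHom.coe_mk, hs, inner_sub_right, hoff]
    rw [Finset.sum_sub_distrib]
    congr 1
    · rw [Finset.sum_eq_single i]
      · simp [hdiag]
      · intro k _ hk
        simp [hk]
      · simp
    · rw [map_sum]
      simp
  rw [← hl', ← h, hΦ]
  ring

/-! ### The resolvent -/

/-- On the Fourier side `y ∂ₓ` is the transport operator `-∂₁ ξ₀`, the transpose of `ξ₀ ∂₁`. -/
theorem fourier_mul_lineDeriv_apply (T : 𝓢'(R3, ℂ)) (ψ : 𝓢(R3, ℂ)) :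
    𝓕 (TemperedDistribution.smulLeftCLM ℂ (fun p : R3 => ((p 1 : ℝ) : ℂ))
      (∂_{(EuclideanSpace.single 0 (1 : ℝ) : R3)} T)) ψ =
    𝓕 T (SchwartzMap.smulLeftCLM ℂ (fun ξ : R3 => ((ξ 0 : ℝ) : ℂ))
      (∂_{(EuclideanSpace.single 1 (1 : ℝ) : R3)} ψ)) := by
  have h0 := hasTemperateGrowth_coord 0
  have h1 := hasTemperateGrowth_coord 1
  simp only [TemperedDistribution.fourier_apply, TemperedDistribution.smulLeftCLM_apply_apply,
    TemperedDistribution.lineDerivOp_apply_apply]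
  congr 1
  have e1 : 𝓕 (∂_{(EuclideanSpace.single 1 (1 : ℝ) : R3)} ψ) = (2 * Real.pi * Complex.I) •
      SchwartzMap.smulLeftCLM ℂ (fun ξ : R3 => ((ξ 1 : ℝ) : ℂ)) (𝓕 ψ) := by
    rw [SchwartzMap.fourier_lineDerivOp_eq]
    congr 1
    ext ξ
    rw [SchwartzMap.smulLeftCLM_apply_apply (by fun_prop), SchwartzMap.smulLeftCLM_apply_apply h1,
      inner_single_one]
    simp
  have e2 : ∀ χ : 𝓢(R3, ℂ), 𝓕 (SchwartzMap.smulLeftCLM ℂ (fun ξ : R3 => ((ξ 0 : ℝ) : ℂ)) χ) =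
      (-(2 * Real.pi * Complex.I))⁻¹ • ∂_{(EuclideanSpace.single 0 (1 : ℝ) : R3)} (𝓕 χ) := by
    intro χ
    rw [SchwartzMap.lineDerivOp_fourier_eq, FourierTransform.fourier_smul, smul_smul,
      inv_mul_cancel₀ (neg_ne_zero.2 Complex.two_pi_I_ne_zero), one_smul]
    congr 1
    ext ξ
    rw [SchwartzMap.smulLeftCLM_apply_apply h0, SchwartzMap.smulLeftCLM_apply_apply (by fun_prop),
      inner_single_one]
    simp
  rw [e2, e1, lineDerivOp_smul, smul_smul, inv_neg, neg_mul,
    inv_mul_cancel₀ Complex.two_pi_I_ne_zero, neg_one_smul]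

theorem fourier_sub_L2 (u v : L2) : 𝓕 (u - v) = (𝓕 u - 𝓕 v : L2) :=
  map_sub (Lp.fourierTransformₗᵢ R3 ℂ) u v

/-- `z - 𝓛` is onto. -/
theorem exists_sub_linearizedOp_eq {ν f : ℝ} (hν : 0 < ν) (hf0 : 0 < f) (hf1 : f < 1) {z : ℂ}
    (hz : upperRate f < z.re) (g : L2Vec) :
    ∃ u : (linearizedOp ν f).domain, z • (u : L2Vec) - linearizedOp ν f u = g := by
  set κ : ℝ := (2 * Real.pi) ^ 2 * ν with hκdef
  have hκ : 0 < κ := by positivity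
  obtain ⟨w, U, hU, hweak⟩ := exists_weak_solution hf0 hf1 hκ hz (fourierVec g)
  let u : L2Vec := WithLp.toLp 2 fun i => 𝓕⁻ (U i)
  have hFu : ∀ i, 𝓕 (u i) = U i := fun i => fourier_fourierInv_eq _
  -- `Δ u` is square-integrable because `|ξ|²` times the weight is bounded
  have hlap : ∀ i, ∃ d : L2, toDist d = Δ (toDist (u i)) := fun i => by
    have hmem : MemLp (fun ξ : R3 => ((-(2 * Real.pi) ^ 2 * ‖ξ‖ ^ 2 : ℝ) : ℂ) * U i ξ) 2
        (volume : Measure R3) := by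
      refine MemLp.of_le_mul (c := 1 / ν) (Lp.memLp (w i)) ?_ ?_
      · refine AEStronglyMeasurable.mul ?_ (Lp.aestronglyMeasurable _)
        exact Continuous.aestronglyMeasurable (by fun_prop)
      · filter_upwards [hU i] with ξ h
        rw [h, ← mul_assoc, norm_mul, ← Complex.ofReal_mul, Complex.norm_real]
        refine mul_le_mul_of_nonneg_right ?_ (norm_nonneg _)
        have hm : weight κ ξ * (1 + κ * ‖ξ‖ ^ 2) = 1 := by
          rw [weight_eq hκ]
          exact inv_mul_cancel₀ (by positivity)
        have hpos := weight_pos κ ξ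
        rw [neg_mul, neg_mul, norm_neg, Real.norm_of_nonneg (by positivity), le_div_iff₀ hν]
        have : (2 * Real.pi) ^ 2 * ‖ξ‖ ^ 2 * weight κ ξ * ν = weight κ ξ * (κ * ‖ξ‖ ^ 2) := by
          rw [hκdef]; ring
        linarith
    refine ⟨𝓕⁻ (hmem.toLp _), toDist_eq_laplacian_iff.2 ?_⟩
    rw [fourier_fourierInv_eq, hFu]
    exact hmem.coeFn_toLp
  choose d hd using hlap
  -- `y ∂ₓ u` is given by the equation
  let v : Fin 3 → L2 := fun i => g i - (z • u i - (ν : ℂ) • d i) + boundedPart f u i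
  have hv : ∀ i, toDist (v i) = TemperedDistribution.smulLeftCLM ℂ
      (fun p : R3 => ((p 1 : ℝ) : ℂ))
      (∂_{(EuclideanSpace.single 0 (1 : ℝ) : R3)} (toDist (u i))) := fun i => by
    have hFv : 𝓕 (v i) = 𝓕 (g i) - 𝓕 (z • u i - (ν : ℂ) • d i) + 𝓕 (boundedPart f u i) := by
      simp only [v, FourierTransform.fourier_add, fourier_sub_L2]
    have hdiag : toDist (𝓕 (z • u i - (ν : ℂ) • d i)) = TemperedDistribution.smulLeftCLM ℂ
        (fun ξ : R3 => z + ((κ * ‖ξ‖ ^ 2 : ℝ) : ℂ)) (toDist (U i)) := by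
      refine toDist_eq_smulLeftCLM_of_ae (hasTemperateGrowth_add_normSq z κ) ?_
      rw [fourier_sub_L2, FourierTransform.fourier_smul,
        FourierTransform.fourier_smul, hFu]
      filter_upwards [toDist_eq_laplacian_iff.1 (hd i), Lp.coeFn_smul z (U i),
        Lp.coeFn_smul (ν : ℂ) (𝓕 (d i) : L2), Lp.coeFn_sub (z • U i) ((ν : ℂ) • 𝓕 (d i) : L2)]
        with ξ h1 h2 h3 h4
      rw [h4, Pi.sub_apply, h2, h3, Pi.smul_apply, Pi.smul_apply, h1, hFu, hκdef]
      simp only [smul_eq_mul]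
      push_cast
      ring
    have hF : 𝓕 (toDist (v i)) = 𝓕 (TemperedDistribution.smulLeftCLM ℂ
        (fun p : R3 => ((p 1 : ℝ) : ℂ))
        (∂_{(EuclideanSpace.single 0 (1 : ℝ) : R3)} (toDist (u i)))) := by
      ext ψ
      have hw := hweak i ψ
      have hsum : (∑ j, mulL2 (symbol f i j) (memLp_symbol f i j) (U j)) =
          𝓕 (boundedPart f u i) := by
        rw [fourier_boundedPart]
        simp only [hFu]
      have hsplit : transposeCLM z κ ψ =
          SchwartzMap.smulLeftCLM ℂ (fun ξ : R3 => z + ((κ * ‖ξ‖ ^ 2 : ℝ) : ℂ)) ψ +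
          SchwartzMap.smulLeftCLM ℂ (fun ξ : R3 => ((ξ 0 : ℝ) : ℂ))
            (∂_{(EuclideanSpace.single 1 (1 : ℝ) : R3)} ψ) := rfl
      rw [fourier_mul_lineDeriv_apply, fourier_toDist, fourier_toDist, hFu, hFv, map_add, map_sub,
        hdiag]
      rw [hsum, hsplit, map_add] at hw
      change toDist (𝓕 (g i)) ψ - toDist (U i) _ + toDist (𝓕 (boundedPart f u i)) ψ = _
      change _ = _ + toDist (𝓕 (g i)) ψ at hw
      linear_combination -hw
    simpa using congrArg (𝓕⁻ ·) hF
  have hud : ∀ i, u i ∈ laplacianL2.domain := fun i =>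
    ⟨d i, (hd i).trans (TemperedDistribution.laplacianCLM_apply _).symm⟩
  have huy : ∀ i, u i ∈ yDx.domain := fun i => ⟨v i, hv i⟩
  have hd' : ∀ i, laplacianL2 ⟨u i, hud i⟩ = d i := fun i =>
    toDist_injective ((toDist_laplacianL2 _).trans (hd i).symm)
  have hv' : ∀ i, yDx ⟨u i, huy i⟩ = v i := fun i =>
    toDist_injective ((toDist_yDx _).trans (hv i).symm)
  refine ⟨⟨u, (mem_linearizedOp_domain ν f u).2 ⟨hud, huy⟩⟩, ?_⟩
  ext1 i
  rw [PiLp.sub_apply, linearizedOp_apply, hd', hv', PiLp.smul_apply]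
  simp only [v]
  abel

/-- The a priori estimate that follows from dissipativity. -/
theorem norm_le_of_sub_linearizedOp {ν f : ℝ} (hν : 0 < ν) (hf0 : 0 < f) (hf1 : f < 1) {z : ℂ}
    (hz : upperRate f < z.re) (u : (linearizedOp ν f).domain) :
    ‖(u : L2Vec)‖ ≤ 1 / (z.re - upperRate f) * ‖z • (u : L2Vec) - linearizedOp ν f u‖ := by
  have hδ : 0 < z.re - upperRate f := sub_pos.2 hz
  have h1 := re_inner_linearizedOp_le hν hf0 hf1 u
  have h2 : (inner ℂ (u : L2Vec) (z • (u : L2Vec) - linearizedOp ν f u)).re =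
      z.re * ‖(u : L2Vec)‖ ^ 2 - (inner ℂ (u : L2Vec) (linearizedOp ν f u)).re := by
    have h : inner ℂ (u : L2Vec) (u : L2Vec) = ((‖(u : L2Vec)‖ ^ 2 : ℝ) : ℂ) := by
      rw [inner_self_eq_norm_sq_to_K]
      push_cast
      rfl
    rw [inner_sub_right, inner_smul_right, Complex.sub_re, h, Complex.re_mul_ofReal]
  have h3 := (Complex.re_le_norm _).trans (norm_inner_le_norm (𝕜 := ℂ) (u : L2Vec)
    (z • (u : L2Vec) - linearizedOp ν f u))
  rw [one_div_mul_eq_div, le_div_iff₀ hδ]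
  obtain h0 | h0 := (norm_nonneg (u : L2Vec)).eq_or_lt
  · rw [← h0, zero_mul]; exact norm_nonneg _
  · refine le_of_mul_le_mul_left ?_ h0
    linarith

end Couette

end

theorem mainTheorem3 (ν f : ℝ) (hν : 0 < ν) (hf0 : 0 < f) (hf1 : f < 1) (z : ℂ)
    (hz : Couette.upperRate f < z.re) :
    z ∈ (Couette.linearizedOp ν f).resolventSet ∧
      ∀ R : Couette.L2Vec →L[ℂ] Couette.L2Vec,
        (Couette.linearizedOp ν f).IsResolventAt z R →
          ‖R‖ ≤ 1 / (z.re - Couette.upperRate f) := by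
  have hδ : 0 < z.re - Couette.upperRate f := sub_pos.2 hz
  have hbound := Couette.norm_le_of_sub_linearizedOp hν hf0 hf1 hz
  refine ⟨?_, fun R hR => ?_⟩
  · let T : (Couette.linearizedOp ν f).domain →ₗ[ℂ] Couette.L2Vec :=
      z • (Couette.linearizedOp ν f).domain.subtype - (Couette.linearizedOp ν f).toFun
    have hT : ∀ u, T u = z • (u : Couette.L2Vec) - Couette.linearizedOp ν f u := fun _ => rfl
    have hinj : Function.Injective T := by
      refine (injective_iff_map_eq_zero T).2 fun u hu => ?_
      have h := hbound u
      rw [← hT, hu, norm_zero, mul_zero] at h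
      exact Subtype.ext (norm_le_zero_iff.1 h)
    have hsurj : Function.Surjective T :=
      Couette.exists_sub_linearizedOp_eq hν hf0 hf1 hz
    let e := LinearEquiv.ofBijective T ⟨hinj, hsurj⟩
    let R : Couette.L2Vec →L[ℂ] Couette.L2Vec :=
      ((Couette.linearizedOp ν f).domain.subtype ∘ₗ e.symm.toLinearMap).mkContinuous
        (1 / (z.re - Couette.upperRate f)) fun w => by
          have h := hbound (e.symm w)
          rw [← hT] at h
          exact h.trans_eq (congrArg (fun x => 1 / (z.re - Couette.upperRate f) * ‖x‖)
            (e.apply_symm_apply w))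
    refine ⟨R, fun w => ⟨(e.symm w).2, e.apply_symm_apply w⟩, fun u => ?_⟩
    exact congrArg Subtype.val (e.symm_apply_apply u)
  · refine R.opNorm_le_bound (by positivity) fun w => ?_
    obtain ⟨hw, hRw⟩ := hR.1 w
    have h := hbound ⟨R w, hw⟩
    rwa [hRw] at h
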